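/- A partition $\pi$ of $n$ ($\pi\vdash n$) has rank equal to its largest part minus its number of parts; its crank is its largest part if $1$ is not a part, and otherwise it is the number of parts larger than $w$ minus $w$, where $w$ is the number of ones in $\pi$. Let $N(m,n)$ be the number of partitions of $n$ with rank $m$, and for $n\ne 1$ let $M(m,n)$ be the number of partitions of $n$ with crank $m$; for $n=1$ put $M(-1,1)=M(1,1)=1$, $M(0,1)=-1$, and $M(m,1)=0$ otherwise. The symmetrized rank and crank moments are $$\eta_k(n)=\sum_{m=-n}^{n}\binom{m+\lfloor\frac{k-1}{2}\rfloor}{k}N(m,n),\qquad \mu_k(n)=\sum_{m=-n}^{n}\binom{m+\lfloor\frac{k-1}{2}\rfloor}{k}M(m,n),$$ where $\binom{x}{k}=x(x-1)\cdots(x-k+1)/k!$ for every integer $x$. If the different parts of $\pi$ are $n_1<n_2<\cdots<n_m$, let $f_j=f_j(\pi)$ be the number of times the part $n_j$ occurs in $\pi$ ($1\le j\le m$). For $k\ge 1$ and $n\ge 1$ define $$\omega_k(\pi)=\sum_{m_1+m_2+\cdots+m_r=k}\binom{f_1+m_1-1}{2m_1-1}\sum_{2\le j_2<j_3<\cdots<j_r\le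 m}\binom{f_{j_2}+m_2}{2m_2}\binom{f_{j_3}+m_3}{2m_3}\cdots\binom{f_{j_r}+m_r}{2m_r},\qquad \mathrm{spt}_k(n)=\sum_{\pi\vdash n}\omega_k(\pi),$$ where the outer sum is over all compositions $m_1+\cdots+m_r$ of $k$ into positive integers ($1\le r\le k$), and the inner sum is $1$ when $r=1$. Theorem. For all integers $k\ge 1$ and $n\ge 1$, $$\mathrm{spt}_k(n)=\mu_{2k}(n)-\eta_{2k}(n).$$ -/

import Mathlib

namespace SptMoments

/-- The largest part of a partition (`0` for the empty partition). -/
def largestPart {n : ℕ} (p : n.Partition) : ℕ := p.parts.sup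

/-- The rank of a partition: its largest part minus its number of parts. -/
def rank {n : ℕ} (p : n.Partition) : ℤ :=
  (largestPart p : ℤ) - (Multiset.card p.parts : ℤ)

/-- The crank of a partition (Andrews and Garvan): the largest part if `1` is not a part; otherwise
the number of parts that are larger than the number of ones, minus the number of ones. -/
def crank {n : ℕ} (p : n.Partition) : ℤ :=
  if p.parts.count 1 = 0 then (largestPart p : ℤ)
  else (Multiset.card (p.parts.filter (fun a => p.parts.count 1 < a)) : ℤ)
    - (p.parts.count 1 : ℤ)

/-- `N(m, n)`: the number of partitions of `n` with rank `m`. -/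
def rankCount (m : ℤ) (n : ℕ) : ℤ :=
  ((Finset.univ.filter (fun p : n.Partition => rank p = m)).card : ℤ)

/-- `M(m, n)`: the number of partitions of `n` with crank `m` for `n ≠ 1`, with the customary
convention `M(-1, 1) = 1`, `M(0, 1) = -1`, `M(1, 1) = 1`, and `M(m, 1) = 0` otherwise. -/
def crankCount (m : ℤ) (n : ℕ) : ℤ :=
  if n = 1 then
    (if m = -1 then 1 else if m = 0 then -1 else if m = 1 then 1 else 0)
  else ((Finset.univ.filter (fun p : n.Partition => crank p = m)).card : ℤ)

/-- The symmetrized rank moment `η_k(n) = ∑_{m=-n}^{n} binom(m + ⌊(k-1)/2⌋, k) N(m, n)`.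
Here `Ring.choose` on `ℤ` is `x (x-1) ⋯ (x-k+1) / k!`, also for negative `x`, and division of
integers by `2` rounds down. -/
noncomputable def eta (k n : ℕ) : ℤ :=
  ∑ m ∈ Finset.Icc (-(n : ℤ)) (n : ℤ), Ring.choose (m + ((k : ℤ) - 1) / 2) k * rankCount m n

/-- The symmetrized crank moment `μ_k(n) = ∑_{m=-n}^{n} binom(m + ⌊(k-1)/2⌋, k) M(m, n)`. -/
noncomputable def mu (k n : ℕ) : ℤ :=
  ∑ m ∈ Finset.Icc (-(n : ℤ)) (n : ℤ), Ring.choose (m + ((k : ℤ) - 1) / 2) k * crankCount m n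

/-- The number of different parts of a partition. -/
def numDistinct {n : ℕ} (p : n.Partition) : ℕ := p.parts.toFinset.card

/-- The `j`-th smallest of the different parts `n_1 < n_2 < ⋯` of a partition, for
`1 ≤ j ≤ numDistinct p`. -/
def distinctPart {n : ℕ} (p : n.Partition) (j : ℕ) : ℕ :=
  (p.parts.toFinset.sort (· ≤ ·)).getD (j - 1) 0

/-- `f_j`: the frequency (multiplicity) of the part `n_j`, for `1 ≤ j ≤ numDistinct p`. -/
def freq {n : ℕ} (p : n.Partition) (j : ℕ) : ℕ := p.parts.count (distinctPart p j)

/-- The `i`-th summand `m_i` of a composition `m_1 + ⋯ + m_r = k`, for `1 ≤ i ≤ r`. -/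
def summand {k : ℕ} (c : Composition k) (i : ℕ) : ℕ := c.blocks.getD (i - 1) 0

/-- The tuples of indices `2 ≤ j_2 < j_3 < ⋯ < j_r ≤ m`, where `j_{i+2}` is the value at
`i : Fin (r - 1)`. For `r = 1` there is exactly one, the empty tuple. -/
def indexTuples (r m : ℕ) : Finset (Fin (r - 1) → ℕ) :=
  (Fintype.piFinset (fun _ : Fin (r - 1) => Finset.Icc 2 m)).filter
    (fun j => ∀ a b : Fin (r - 1), a < b → j a < j b)

/-- The weight `ω_k(π)` (for `k ≥ 1` and a non-empty partition `π`): the sum over all compositions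
`m_1 + ⋯ + m_r = k` of
`binom(f_1 + m_1 - 1, 2 m_1 - 1) ∑_{2 ≤ j_2 < ⋯ < j_r} ∏_{i=2}^{r} binom(f_{j_i} + m_i, 2 m_i)`. -/
def omega (k : ℕ) {n : ℕ} (p : n.Partition) : ℕ :=
  ∑ c : Composition k,
    (freq p 1 + summand c 1 - 1).choose (2 * summand c 1 - 1) *
      ∑ j ∈ indexTuples c.length (numDistinct p),
        ∏ i : Fin (c.length - 1),
          (freq p (j i) + summand c ((i : ℕ) + 2)).choose (2 * summand c ((i : ℕ) + 2))

/-- The higher order spt-function `spt_k(n) = ∑_{π ⊢ n} ω_k(π)`. -/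
def spt (k n : ℕ) : ℕ := ∑ p : n.Partition, omega k p

end SptMoments

/-!
Write `P` for the generating function of the partition numbers and `s` for a variable marking `k`.
The weights `∑ binom(f + m, 2 m) s^m` and `∑ binom(f + m - 1, 2 m - 1) s^m` of a part occurring `f`
times satisfy the recurrence `a (f + 2) = (2 + s) a (f + 1) - a f`. Hence the generating function of
the spt weights of partitions into parts at most `N` satisfies a recurrence in `N`, and the Bailey
pair relation `∑ α_r (q)_N / ((q)_{N-r} (q)_{N+r}) = 1`, where `α` is the difference of the unit
pair and the pair with pentagonal exponents, solves it. As `N → ∞` the kernel tends to `P`.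

On the other side, Dyson's map shows that the generating function `G_r` of the partitions with rank
at least `r` satisfies `G_r = q^(r+1) (P - G_{r+3})`, and that of the partitions with crank at least
`r` satisfies `G_r = q^r (P - G_{r+1})`, a consequence of Durfee rectangle identities. Iterating
these recurrences and summing by parts turns the symmetrized moments into Appell sums, whose
exponents `j (3j ± 1) / 2` for the rank and `j (j ± 1) / 2` for the crank are those of the two
Bailey pairs; their difference is the sum over `α` term by term.
-/

namespace SptMoments

open Finset PowerSeries

section PartSeries

variable {R S : Type*} [CommRing R] [CommRing S]

/-- The power series `∑ c, a c * X ^ (i * c)`: the contribution of the part `i` to a generating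
function over partitions in which a part `i` occurring `c` times has weight `a c`. -/
noncomputable def partSeries (i : ℕ) (a : ℕ → R) : R⟦X⟧ :=
  PowerSeries.mk fun m => if i ∣ m then a (m / i) else 0

theorem coeff_partSeries (i m : ℕ) (a : ℕ → R) :
    coeff m (partSeries i a) = if i ∣ m then a (m / i) else 0 := by
  simp [partSeries]

theorem coeff_mul_partSeries {i : ℕ} (hi : i ≠ 0) (c : ℕ) (a : ℕ → R) :
    coeff (c * i) (partSeries i a) = a c := by
  simp [coeff_partSeries, Nat.pos_of_ne_zero hi]

theorem partSeries_eq_expand {i : ℕ} (hi : i ≠ 0) (a : ℕ → R) :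
    partSeries i a = expand i hi (PowerSeries.mk a) := by
  ext m
  simp [coeff_partSeries, coeff_expand]

theorem map_partSeries (f : R →+* S) (i : ℕ) (a : ℕ → R) :
    PowerSeries.map f (partSeries i a) = partSeries i (fun c => f (a c)) := by
  ext m
  simp [coeff_partSeries, apply_ite f]

theorem partSeries_single {i : ℕ} (hi : i ≠ 0) (w : ℕ) :
    partSeries i (fun c => if c = w then (1 : R) else 0) = X ^ (i * w) := by
  have mk_ite : PowerSeries.mk (fun c => if c = w then (1 : R) else 0) = X ^ w := by
    ext c
    simp [coeff_X_pow]
  rw [partSeries_eq_expand hi, mk_ite, map_pow, expand_X, pow_mul]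

theorem one_sub_C_mul_X_pow_mul_partSeries {i : ℕ} (hi : i ≠ 0) (z : R) :
    (1 - C z * X ^ i) * partSeries i (fun c => z ^ c) = 1 := by
  have geometric : (1 - C z * X) * PowerSeries.mk (fun c => z ^ c) = 1 := by
    ext c
    cases c <;> simp [sub_mul, mul_assoc, coeff_succ_X_mul, pow_succ', coeff_one]
  rw [partSeries_eq_expand hi]
  simpa [expand_C] using congrArg (expand i hi) geometric

theorem one_sub_X_pow_mul_partSeries {i : ℕ} (hi : i ≠ 0) :
    (1 - X ^ i) * partSeries i (fun _ => (1 : R)) = 1 := by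
  simpa using one_sub_C_mul_X_pow_mul_partSeries hi (1 : R)

theorem X_pow_dvd_partSeries {i : ℕ} {a : ℕ → R} (ha : a 0 = 0) : X ^ i ∣ partSeries i a := by
  rw [X_pow_dvd_iff]
  intro m hm
  rw [coeff_partSeries, ite_eq_right_iff]
  intro hdvd
  simp [Nat.eq_zero_of_dvd_of_lt hdvd hm, ha]

theorem exists_partition_count_eq {s : Finset ℕ} (hs : 0 ∉ s) (c : ℕ → ℕ) :
    ∃ p : (∑ i ∈ s, c i * i).Partition,
      (∀ i ∈ s, p.parts.count i = c i) ∧ ∀ i ∈ p.parts, i ∈ s := by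
  have mem_of_mem_parts : ∀ i ∈ ∑ j ∈ s, Multiset.replicate (c j) j, i ∈ s := by
    intro i hi
    obtain ⟨j, hj, hij⟩ := Multiset.mem_sum.mp hi
    rwa [Multiset.eq_of_mem_replicate hij]
  refine ⟨⟨∑ j ∈ s, Multiset.replicate (c j) j, fun {i} hi => ?_, ?_⟩, fun i hi => ?_,
    mem_of_mem_parts⟩
  · exact Nat.pos_of_ne_zero fun h => hs (h ▸ mem_of_mem_parts i hi)
  · simp [Multiset.sum_sum]
  · simp [Multiset.count_sum', Multiset.count_replicate, hi]

theorem sum_prod_count_eq_coeff (φ : ℕ → ℕ → R) {s : Finset ℕ} (hs : 0 ∉ s) (n : ℕ) :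
    ∑ p : n.Partition with ∀ i ∈ p.parts, i ∈ s, ∏ i ∈ s, φ i (p.parts.count i) =
      coeff n (∏ i ∈ s, partSeries i (φ i)) := by
  rw [coeff_prod]
  refine sum_of_injOn Nat.Partition.toFinsuppAntidiag
    (Nat.Partition.toFinsuppAntidiag_injective n).injOn ?_ ?_ ?_
  · intro p hp
    have hparts : p.parts.toFinset ⊆ s := fun i hi =>
      (mem_filter.mp hp).2 i (Multiset.mem_toFinset.mp hi)
    rw [mem_coe, mem_finsuppAntidiag']
    refine ⟨?_, hparts⟩
    exact (mem_finsuppAntidiag'.mp p.toFinsuppAntidiag_mem_finsuppAntidiag).1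
  · intro g hg hnot_image
    obtain ⟨hsum, hsupport⟩ := mem_finsuppAntidiag.mp hg
    by_contra hprod
    have hdvd : ∀ i ∈ s, i ∣ g i := fun i hi => by
      by_contra hndvd
      exact hprod (prod_eq_zero hi (by rw [coeff_partSeries, if_neg hndvd]))
    obtain rfl : ∑ i ∈ s, g i / i * i = n :=
      (sum_congr rfl fun i hi => Nat.div_mul_cancel (hdvd i hi)).trans hsum
    obtain ⟨p, hcount, hparts⟩ := exists_partition_count_eq hs fun i => g i / i
    refine hnot_image ⟨p, by simpa using hparts, Finsupp.ext fun i => ?_⟩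
    change p.parts.count i * i = g i
    by_cases hi : i ∈ s
    · rw [hcount i hi, Nat.div_mul_cancel (hdvd i hi)]
    · rw [Multiset.count_eq_zero_of_notMem (fun h => hi (hparts i h)), zero_mul,
        Finsupp.notMem_support_iff.mp fun h => hi (hsupport h)]
  · intro p _
    exact prod_congr rfl fun i hi =>
      (coeff_mul_partSeries (ne_of_mem_of_not_mem hi hs) _ _).symm

theorem sum_prod_count_Icc_eq_coeff (φ : ℕ → ℕ → R) {n N : ℕ} (h : n ≤ N) :
    ∑ p : n.Partition, ∏ i ∈ Icc 1 N, φ i (p.parts.count i) =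
      coeff n (∏ i ∈ Icc 1 N, partSeries i (φ i)) := by
  rw [← sum_prod_count_eq_coeff φ (by simp), filter_true_of_mem]
  exact fun p _ i hi =>
    mem_Icc.mpr ⟨p.parts_pos hi, (Nat.Partition.le_of_mem_parts hi).trans h⟩

theorem coeff_eq_of_X_pow_dvd_sub {f g : R⟦X⟧} {m n : ℕ} (h : X ^ m ∣ f - g) (hn : n < m) :
    coeff n f = coeff n g :=
  sub_eq_zero.mp (by simpa using X_pow_dvd_iff.mp h n hn)

theorem eq_of_forall_X_pow_dvd_sub {f g : R⟦X⟧} (h : ∀ n, X ^ (n + 1) ∣ f - g) : f = g :=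
  PowerSeries.ext fun n => coeff_eq_of_X_pow_dvd_sub (h n) n.lt_succ_self

/-- The `q`-Pochhammer symbol `(q)_n = (1 - q) (1 - q ^ 2) ⋯ (1 - q ^ n)`, where `q` is the
variable of the power series. -/
noncomputable def qPoch (R : Type*) [CommRing R] (n : ℕ) : R⟦X⟧ :=
  ∏ i ∈ range n, (1 - X ^ (i + 1))

/-- The inverse `1 / (q)_n` of `qPoch R n`, the generating function of the partitions into parts
of size at most `n`. -/
noncomputable def qInv (R : Type*) [CommRing R] (n : ℕ) : R⟦X⟧ :=
  ∏ i ∈ range n, partSeries (i + 1) (fun _ => 1)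

@[simp] theorem qPoch_zero : qPoch R 0 = 1 := prod_range_zero _

@[simp] theorem qInv_zero : qInv R 0 = 1 := prod_range_zero _

theorem qPoch_succ (n : ℕ) : qPoch R (n + 1) = qPoch R n * (1 - X ^ (n + 1)) :=
  prod_range_succ _ _

theorem qInv_succ (n : ℕ) :
    qInv R (n + 1) = qInv R n * partSeries (n + 1) (fun _ => 1) :=
  prod_range_succ _ _

theorem one_sub_mul_qInv_succ (n : ℕ) : (1 - X ^ (n + 1)) * qInv R (n + 1) = qInv R n := by
  rw [qInv_succ, mul_left_comm, one_sub_X_pow_mul_partSeries n.succ_ne_zero, mul_one]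

theorem qPoch_mul_qInv (n : ℕ) : qPoch R n * qInv R n = 1 := by
  induction n with
  | zero => simp
  | succ n ih => rw [qPoch_succ, mul_assoc, one_sub_mul_qInv_succ, ih]

theorem map_qInv (f : R →+* S) (n : ℕ) : PowerSeries.map f (qInv R n) = qInv S n := by
  simp [qInv, map_prod, map_partSeries]

theorem X_pow_dvd_qInv_sub {m n : ℕ} (h : m ≤ n) : X ^ (m + 1) ∣ qInv R n - qInv R m := by
  induction n, h using Nat.le_induction with
  | base => simp
  | succ n hmn ih =>
    have hsplit : qInv R (n + 1) - qInv R m =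
        X ^ (n + 1) * qInv R (n + 1) + (qInv R n - qInv R m) := by
      rw [← one_sub_mul_qInv_succ n]; ring
    rw [hsplit]
    exact dvd_add (Dvd.dvd.mul_right (pow_dvd_pow _ (by omega)) _) ih

theorem qInv_eq_prod_Icc (n : ℕ) : qInv R n = ∏ i ∈ Icc 1 n, partSeries i (fun _ => 1) := by
  rw [qInv, range_eq_Ico, prod_Ico_add' (fun i => partSeries i fun _ => (1 : R)) 0 n 1]
  rfl

/-- The generating function of the partition numbers. -/
noncomputable def partitionSeries (R : Type*) [CommRing R] : R⟦X⟧ :=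
  PowerSeries.mk fun n => (Fintype.card n.Partition : R)

theorem coeff_partitionSeries {n N : ℕ} (h : n ≤ N) :
    coeff n (partitionSeries R) = coeff n (qInv R N) := by
  rw [qInv_eq_prod_Icc, ← sum_prod_count_Icc_eq_coeff _ h]
  simp [partitionSeries]

theorem X_pow_dvd_partitionSeries_sub (N : ℕ) : X ^ (N + 1) ∣ partitionSeries R - qInv R N := by
  rw [X_pow_dvd_iff]
  intro m hm
  rw [map_sub, coeff_partitionSeries (Nat.lt_succ_iff.mp hm), sub_self]

end PartSeries

section Tsum

open scoped PowerSeries.WithPiTopology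

variable {R : Type*} [CommRing R] [TopologicalSpace R] {F : ℕ → R⟦X⟧}

theorem hasSum_coeff_of_X_pow_dvd (hF : ∀ w, X ^ w ∣ F w) (n : ℕ) :
    HasSum (fun w => coeff n (F w)) (∑ w ∈ range (n + 1), coeff n (F w)) :=
  hasSum_sum_of_ne_finset_zero fun w hw =>
    X_pow_dvd_iff.mp (hF w) n (by simpa using hw)

theorem summable_of_X_pow_dvd (hF : ∀ w, X ^ w ∣ F w) : Summable F :=
  (WithPiTopology.summable_iff_summable_coeff R).mpr fun n =>
    (hasSum_coeff_of_X_pow_dvd hF n).summable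

variable [T2Space R]

theorem coeff_tsum_of_X_pow_dvd (hF : ∀ w, X ^ w ∣ F w) (n : ℕ) :
    coeff n (∑' w, F w) = ∑ w ∈ range (n + 1), coeff n (F w) :=
  ((WithPiTopology.hasSum_iff_hasSum_coeff R).mp (summable_of_X_pow_dvd hF).hasSum n).unique
    (hasSum_coeff_of_X_pow_dvd hF n)

theorem X_pow_dvd_tsum {M : ℕ} (hF : ∀ w, X ^ (M + w) ∣ F w) : X ^ M ∣ ∑' w, F w := by
  rw [X_pow_dvd_iff]
  intro n hn
  rw [coeff_tsum_of_X_pow_dvd fun w => (pow_dvd_pow X (Nat.le_add_left w M)).trans (hF w)]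
  exact sum_eq_zero fun w _ => X_pow_dvd_iff.mp (hF w) n (by omega)

end Tsum

section Bailey

variable {R : Type*} [CommRing R]

theorem choose_two_succ (r : ℕ) : (r + 2).choose 2 = (r + 1).choose 2 + (r + 1) := by
  rw [Nat.choose_succ_succ' (r + 1) 1, Nat.choose_one_right, add_comm]

theorem one_sub_X_pow_mul_left_cancel {i : ℕ} (hi : i ≠ 0) {f g : R⟦X⟧}
    (h : (1 - X ^ i) * f = (1 - X ^ i) * g) : f = g :=
  (IsUnit.of_mul_eq_one _ (one_sub_X_pow_mul_partSeries hi)).mul_left_cancel h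

/-- The kernel `(q)_N / ((q)_{N - r} (q)_{N + r})` relating the two sequences of a Bailey pair. It
vanishes for `r > N`, in accordance with `1 / (q)_{-m} = 0` for `m > 0`. -/
noncomputable def baileyKernel (R : Type*) [CommRing R] (N r : ℕ) : R⟦X⟧ :=
  if r ≤ N then qPoch R N * (qInv R (N - r) * qInv R (N + r)) else 0

theorem baileyKernel_of_lt {N r : ℕ} (h : N < r) : baileyKernel R N r = 0 :=
  if_neg h.not_ge

theorem baileyKernel_add_left (t r : ℕ) :
    baileyKernel R (t + r) r = qPoch R (t + r) * (qInv R t * qInv R (t + r + r)) := by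
  rw [baileyKernel, if_pos (Nat.le_add_left r t), Nat.add_sub_cancel]

theorem baileyKernel_zero_right (N : ℕ) : baileyKernel R N 0 = qInv R N := by
  simpa [← mul_assoc, qPoch_mul_qInv] using baileyKernel_add_left (R := R) N 0

theorem one_sub_mul_baileyKernel (N r : ℕ) :
    (1 - X ^ (N - r)) * baileyKernel R N r =
      (1 - X ^ (N + r + 1)) * baileyKernel R N (r + 1) := by
  rcases lt_or_ge r N with h | h
  · obtain ⟨t, rfl⟩ := Nat.exists_eq_add_of_le' h
    rw [baileyKernel_add_left t, show t + r.succ = t + 1 + r by omega, baileyKernel_add_left,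
      Nat.add_sub_cancel, ← one_sub_mul_qInv_succ t, ← one_sub_mul_qInv_succ (t + 1 + r + r),
      show t + 1 + r + (r + 1) = t + 1 + r + r + 1 by omega]
    ring
  · simp [Nat.sub_eq_zero_of_le h, baileyKernel_of_lt (Nat.lt_succ_of_le h)]

theorem one_sub_mul_baileyKernel_succ_left (N r : ℕ) :
    (1 - X ^ (N + 1 - r)) * (1 - X ^ (N + 1 + r)) * baileyKernel R (N + 1) r =
      (1 - X ^ (N + 1)) * baileyKernel R N r := by
  rcases le_or_gt r N with h | h
  · obtain ⟨t, rfl⟩ := Nat.exists_eq_add_of_le' h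
    rw [baileyKernel_add_left, show t + r + 1 = t + 1 + r by omega, baileyKernel_add_left,
      Nat.add_sub_cancel, show t + 1 + r = t + r + 1 by omega, qPoch_succ,
      ← one_sub_mul_qInv_succ t, ← one_sub_mul_qInv_succ (t + r + r),
      show t + r + 1 + r = t + r + r + 1 by omega]
    ring
  · simp [Nat.sub_eq_zero_of_le (Nat.succ_le_of_lt h), baileyKernel_of_lt h]

theorem X_pow_dvd_baileyKernel_sub {N r : ℕ} (h : r ≤ N) :
    X ^ (N - r + 1) ∣ baileyKernel R N r - partitionSeries R := by
  obtain ⟨t, rfl⟩ := Nat.exists_eq_add_of_le' h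
  have hlower := X_pow_dvd_qInv_sub (R := R) (Nat.le_add_right t r)
  have hupper := (pow_dvd_pow X (show t + 1 ≤ t + r + 1 by omega)).trans
    (X_pow_dvd_qInv_sub (R := R) (Nat.le_add_right (t + r) r))
  have hpartition := (pow_dvd_pow X (show t + 1 ≤ t + r + 1 by omega)).trans
    (X_pow_dvd_partitionSeries_sub (R := R) (t + r))
  have hsplit : baileyKernel R (t + r) r - partitionSeries R =
      qPoch R (t + r) * qInv R t * (qInv R (t + r + r) - qInv R (t + r)) -
        (qInv R (t + r) - qInv R t) - (partitionSeries R - qInv R (t + r)) := by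
    rw [baileyKernel_add_left]
    linear_combination qInv R t * qPoch_mul_qInv (R := R) (t + r)
  rw [hsplit, Nat.add_sub_cancel]
  exact dvd_sub (dvd_sub (hupper.mul_left _) hlower) hpartition

theorem one_sub_mul_sum_unit_pair (N M : ℕ) :
    (1 - X ^ N) * ∑ r ∈ range M, (-1) ^ r * X ^ ((r + 1).choose 2) * (1 + X ^ (r + 1)) *
        baileyKernel R N (r + 1) =
      (1 - X ^ N) * baileyKernel R N 0 -
        (-1) ^ M * X ^ ((M + 1).choose 2) * (1 - X ^ (N - M)) * baileyKernel R N M := by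
  induction M with
  | zero => simp
  | succ M ih =>
    rw [sum_range_succ, mul_add, ih, choose_two_succ, mul_assoc _ (1 - X ^ (N - M)),
      one_sub_mul_baileyKernel]
    rcases lt_or_ge M N with h | h
    · obtain ⟨t, rfl⟩ := Nat.exists_eq_add_of_le' h
      rw [Nat.succ_eq_add_one, Nat.add_sub_cancel]
      ring
    · simp [baileyKernel_of_lt (Nat.lt_succ_of_le h)]

theorem sum_unit_pair {N : ℕ} (hN : N ≠ 0) :
    ∑ r ∈ range N, (-1) ^ r * X ^ ((r + 1).choose 2) * (1 + X ^ (r + 1)) *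
        baileyKernel R N (r + 1) = qInv R N := by
  apply one_sub_X_pow_mul_left_cancel hN
  simpa [baileyKernel_zero_right] using one_sub_mul_sum_unit_pair (R := R) N N

theorem one_sub_mul_sum_pentagonal_pair_sub (N M : ℕ) :
    (1 - X ^ (N + 1)) * ∑ r ∈ range M, (-1) ^ r * X ^ (3 * (r + 1).choose 2 + (r + 1)) *
        (1 + X ^ (r + 1)) * (baileyKernel R (N + 1) (r + 1) - baileyKernel R N (r + 1)) =
      (1 - X ^ (N + 1)) * (X ^ (N + 1) * baileyKernel R (N + 1) 0) -
        (-1) ^ M * X ^ (3 * (M + 1).choose 2 + (N + 1)) * (1 - X ^ (N + 1 - M)) *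
          baileyKernel R (N + 1) M := by
  induction M with
  | zero =>
    simp only [range_zero, sum_empty, mul_zero, pow_zero, zero_add, Nat.choose_succ_self, one_mul,
      tsub_zero]
    ring
  | succ M ih =>
    have hleft := one_sub_mul_baileyKernel_succ_left (R := R) N (M + 1)
    rw [sum_range_succ, mul_add, ih, choose_two_succ, mul_assoc _ (1 - X ^ (N + 1 - M)),
      one_sub_mul_baileyKernel]
    rcases le_or_gt M N with h | h
    · obtain ⟨t, rfl⟩ := Nat.exists_eq_add_of_le' h
      rw [show t + M + 1 - (M + 1) = t by omega] at hleft ⊢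
      linear_combination (-1) ^ M * X ^ (3 * (M + 1).choose 2 + (M + 1)) *
        (1 + X ^ (M + 1)) * hleft
    · simp [baileyKernel_of_lt (show N + 1 < M + 1 by omega),
        baileyKernel_of_lt (show N < M + 1 by omega)]

theorem sum_pentagonal_pair (N : ℕ) :
    ∑ r ∈ range N, (-1) ^ r * X ^ (3 * (r + 1).choose 2 + (r + 1)) * (1 + X ^ (r + 1)) *
        baileyKernel R N (r + 1) = qInv R N - 1 := by
  induction N with
  | zero => simp
  | succ N ih =>
    have hdiff : ∑ r ∈ range (N + 1), (-1) ^ r * X ^ (3 * (r + 1).choose 2 + (r + 1)) *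
        (1 + X ^ (r + 1)) * (baileyKernel R (N + 1) (r + 1) - baileyKernel R N (r + 1)) =
        X ^ (N + 1) * qInv R (N + 1) := by
      apply one_sub_X_pow_mul_left_cancel N.succ_ne_zero
      rw [one_sub_mul_sum_pentagonal_pair_sub, baileyKernel_zero_right]
      simp
    simp only [mul_sub, sum_sub_distrib] at hdiff
    rw [sum_range_succ _ N, sum_range_succ _ N, ih, baileyKernel_of_lt N.lt_succ_self] at hdiff
    rw [sum_range_succ]
    linear_combination hdiff - one_sub_mul_qInv_succ (R := R) N

/-- The sequence `α` of the difference of the unit Bailey pair and the Bailey pair with pentagonal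
exponents `r (3 r ± 1) / 2`, with index shifted so that `baileyAlpha R r` is `α_{r + 1}`. -/
noncomputable def baileyAlpha (R : Type*) [CommRing R] (r : ℕ) : R⟦X⟧ :=
  (-1) ^ r * (X ^ ((r + 1).choose 2) - X ^ (3 * (r + 1).choose 2 + (r + 1))) * (1 + X ^ (r + 1))

theorem sum_baileyAlpha {N : ℕ} (hN : N ≠ 0) :
    ∑ r ∈ range N, baileyAlpha R r * baileyKernel R N (r + 1) = 1 := by
  have hsub := congrArg₂ (· - ·) (sum_unit_pair (R := R) hN) (sum_pentagonal_pair (R := R) N)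
  rw [sub_sub_cancel, ← sum_sub_distrib] at hsub
  rw [← hsub]
  refine sum_congr rfl fun r _ => ?_
  rw [baileyAlpha]
  ring

end Bailey

section Weights

theorem mul_partSeries_of_recurrence {R : Type*} [CommRing R] {i : ℕ} (hi : i ≠ 0) (s : R)
    {a : ℕ → R} (ha : ∀ f, a (f + 2) = (2 + s) * a (f + 1) - a f) :
    ((1 - X ^ i) ^ 2 - C s * X ^ i) * partSeries i a =
      C (a 0) + C (a 1 - (2 + s) * a 0) * X ^ i := by
  have hmk : ((1 - X) ^ 2 - C s * X) * PowerSeries.mk a =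
      C (a 0) + C (a 1 - (2 + s) * a 0) * X := by
    have hexpand : ((1 - X) ^ 2 - C s * X : R⟦X⟧) = 1 - C (2 + s) * X + X * X := by
      rw [map_add, map_ofNat]; ring
    rw [hexpand]
    ext f
    rcases f with _ | _ | f
    · simp [add_mul, sub_mul, mul_assoc]
    · simp [add_mul, sub_mul, mul_assoc, coeff_succ_X_mul, coeff_C]
    · simp [add_mul, sub_mul, mul_assoc, coeff_succ_X_mul, ha]
  rw [partSeries_eq_expand hi]
  simpa [expand_C] using congrArg (expand i hi) hmk

/-- The weight `∑ m, binom (f + m) (2 m) s ^ m` of a part occurring `f` times that is not the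
smallest one, where `s` is the variable of the power series. -/
noncomputable def evenWeight (f : ℕ) : ℤ⟦X⟧ :=
  PowerSeries.mk fun m => ((f + m).choose (2 * m) : ℤ)

/-- The weight `∑ m ≥ 1, binom (f + m - 1) (2 m - 1) s ^ m` of a smallest part occurring `f`
times, where `s` is the variable of the power series. -/
noncomputable def oddWeight (f : ℕ) : ℤ⟦X⟧ :=
  X * PowerSeries.mk fun m => ((f + m).choose (2 * m + 1) : ℤ)

@[simp] theorem evenWeight_zero : evenWeight 0 = 1 := by
  ext m
  rcases m with _ | m
  · simp [evenWeight]
  · simp [evenWeight, coeff_one, Nat.choose_eq_zero_of_lt (show m + 1 < 2 * (m + 1) by omega)]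

theorem evenWeight_one : evenWeight 1 = 1 + X := by
  ext m
  rcases m with _ | _ | m
  · simp [evenWeight]
  · simp [evenWeight, coeff_one]
  · simp [evenWeight, coeff_one, coeff_X,
      Nat.choose_eq_zero_of_lt (show 1 + (m + 1 + 1) < 2 * (m + 1 + 1) by omega)]

@[simp] theorem oddWeight_zero : oddWeight 0 = 0 := by
  have hchoose (m : ℕ) : m.choose (2 * m + 1) = 0 := Nat.choose_eq_zero_of_lt (by omega)
  ext m
  rcases m with _ | m <;> simp [oddWeight, coeff_succ_X_mul, hchoose]

theorem oddWeight_one : oddWeight 1 = X := by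
  have hchoose (m : ℕ) : (1 + m).choose (2 * m + 1) = if m = 0 then 1 else 0 := by
    rcases m with _ | m
    · simp
    · simpa using Nat.choose_eq_zero_of_lt (by omega)
  ext m
  rcases m with _ | m <;> simp [oddWeight, coeff_succ_X_mul, hchoose, coeff_X]

theorem choose_second_difference (a b : ℕ) :
    ((a + 2).choose (b + 2) : ℤ) - 2 * ((a + 1).choose (b + 2)) + (a.choose (b + 2)) =
      a.choose b := by
  push_cast [Nat.choose_succ_succ' (a + 1) (b + 1), Nat.choose_succ_succ' a (b + 1),
    Nat.choose_succ_succ' a b]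
  ring

theorem evenWeight_add_two (f : ℕ) :
    evenWeight (f + 2) = (2 + X) * evenWeight (f + 1) - evenWeight f := by
  ext m
  rw [add_mul, map_sub, map_add, ← map_ofNat C, coeff_C_mul]
  rcases m with _ | m
  · simp [evenWeight]
  · have hdiff := choose_second_difference (f + (m + 1)) (2 * m)
    simp only [coeff_succ_X_mul, evenWeight, coeff_mk]
    rw [show f + 2 + (m + 1) = f + (m + 1) + 2 by ring,
      show f + 1 + (m + 1) = f + (m + 1) + 1 by ring, show f + 1 + m = f + (m + 1) by ring,
      mul_add_one]
    linarith

theorem oddWeight_add_two (f : ℕ) :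
    oddWeight (f + 2) = (2 + X) * oddWeight (f + 1) - oddWeight f := by
  ext m
  rw [add_mul, map_sub, map_add, ← map_ofNat C, coeff_C_mul]
  rcases m with _ | _ | m
  · simp [oddWeight]
  · simp only [oddWeight, coeff_succ_X_mul, coeff_zero_X_mul, coeff_mk, Nat.choose_one_right,
      mul_zero, add_zero, zero_add]
    push_cast
    ring
  · have hdiff := choose_second_difference (f + (m + 1)) (2 * m + 1)
    simp only [coeff_succ_X_mul, oddWeight, coeff_mk]
    rw [show f + 2 + (m + 1) = f + (m + 1) + 2 by ring,
      show f + 1 + (m + 1) = f + (m + 1) + 1 by ring, show f + 1 + m = f + (m + 1) by ring,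
      show 2 * (m + 1) + 1 = 2 * m + 1 + 2 by ring]
    linarith

theorem mul_partSeries_evenWeight {i : ℕ} (hi : i ≠ 0) :
    ((1 - X ^ i) ^ 2 - C X * X ^ i) * partSeries i evenWeight = 1 - X ^ i := by
  rw [mul_partSeries_of_recurrence hi X evenWeight_add_two, evenWeight_zero, evenWeight_one,
    show (1 + X - (2 + X) * 1 : ℤ⟦X⟧) = -1 by ring, map_one, map_neg, map_one]
  ring

theorem mul_partSeries_oddWeight {i : ℕ} (hi : i ≠ 0) :
    ((1 - X ^ i) ^ 2 - C X * X ^ i) * partSeries i oddWeight = C X * X ^ i := by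
  simp [mul_partSeries_of_recurrence hi X oddWeight_add_two, oddWeight_one]

/-- The generating function, weighted by the higher order spt-weights, of the non-empty partitions
with parts at most `N`; the summation index is the smallest part. -/
noncomputable def sptSeries (N : ℕ) : ℤ⟦X⟧⟦X⟧ :=
  ∑ a ∈ Icc 1 N, partSeries a oddWeight * ∏ j ∈ Ioc a N, partSeries j evenWeight

theorem sptSeries_succ (N : ℕ) :
    sptSeries (N + 1) =
      sptSeries N * partSeries (N + 1) evenWeight + partSeries (N + 1) oddWeight := by
  rw [sptSeries, sum_Icc_succ_top (Nat.le_add_left 1 N), Ioc_self, prod_empty, mul_one, sptSeries,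
    sum_mul]
  refine congrArg (· + _) (sum_congr rfl fun a ha => ?_)
  rw [prod_Ioc_succ_top (mem_Icc.mp ha).2, mul_assoc]

theorem mul_baileyKernel_mul_partSeries_oddWeight {N r : ℕ} (hr : r ≠ 0) :
    ((1 - X ^ (N + 1)) ^ 2 - C X * X ^ (N + 1)) *
        (baileyKernel ℤ⟦X⟧ (N + 1) r * partSeries r oddWeight) =
      (1 - X ^ (N + 1)) * (baileyKernel ℤ⟦X⟧ N r * partSeries r oddWeight) +
        C X * X ^ (N + 1) * baileyKernel ℤ⟦X⟧ (N + 1) r := by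
  rw [← mul_assoc (1 - X ^ (N + 1)), ← one_sub_mul_baileyKernel_succ_left]
  rcases le_or_gt r (N + 1) with h | h
  · obtain ⟨t, ht⟩ := Nat.exists_eq_add_of_le' h
    rw [ht, Nat.add_sub_cancel]
    linear_combination X ^ t * baileyKernel ℤ⟦X⟧ (t + r) r * mul_partSeries_oddWeight hr
  · simp [baileyKernel_of_lt h]

theorem sptSeries_eq_sum (N : ℕ) :
    sptSeries N = ∑ r ∈ range N,
      baileyAlpha ℤ⟦X⟧ r * (baileyKernel ℤ⟦X⟧ N (r + 1) * partSeries (r + 1) oddWeight) := by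
  induction N with
  | zero => simp [sptSeries]
  | succ N ih =>
    have hN : N + 1 ≠ 0 := N.succ_ne_zero
    have heven := mul_partSeries_evenWeight hN
    have hodd := mul_partSeries_oddWeight hN
    have hunit : IsUnit ((1 - X ^ (N + 1)) ^ 2 - C X * X ^ (N + 1) : ℤ⟦X⟧⟦X⟧) := by
      refine IsUnit.of_mul_eq_one
        (partSeries (N + 1) evenWeight * partSeries (N + 1) (fun _ => 1)) ?_
      rw [← mul_assoc, heven, one_sub_X_pow_mul_partSeries hN]
    have hsptSeries : sptSeries N = ∑ r ∈ range (N + 1),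
        baileyAlpha ℤ⟦X⟧ r * (baileyKernel ℤ⟦X⟧ N (r + 1) * partSeries (r + 1) oddWeight) := by
      rw [ih, sum_range_succ, baileyKernel_of_lt N.lt_succ_self, zero_mul, mul_zero, add_zero]
    apply hunit.mul_left_cancel
    calc ((1 - X ^ (N + 1)) ^ 2 - C X * X ^ (N + 1)) * sptSeries (N + 1)
        = (1 - X ^ (N + 1)) * sptSeries N + C X * X ^ (N + 1) *
            ∑ r ∈ range (N + 1), baileyAlpha ℤ⟦X⟧ r * baileyKernel ℤ⟦X⟧ (N + 1) (r + 1) := by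
          rw [sptSeries_succ, sum_baileyAlpha hN]
          linear_combination sptSeries N * heven + hodd
      _ = _ := by
          rw [hsptSeries, mul_sum, mul_sum, mul_sum, ← sum_add_distrib]
          refine sum_congr rfl fun r _ => ?_
          linear_combination -baileyAlpha ℤ⟦X⟧ r *
            mul_baileyKernel_mul_partSeries_oddWeight (N := N) r.succ_ne_zero

theorem coeff_sptSeries {n N : ℕ} (h : n ≤ N) :
    coeff n (sptSeries N) = coeff n (partitionSeries ℤ⟦X⟧ *
      ∑ r ∈ range N, baileyAlpha ℤ⟦X⟧ r * partSeries (r + 1) oddWeight) := by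
  refine coeff_eq_of_X_pow_dvd_sub (m := N + 1) ?_ (Nat.lt_succ_of_le h)
  rw [sptSeries_eq_sum, mul_sum, ← sum_sub_distrib]
  refine dvd_sum fun r hr => ?_
  have hrN := mem_range.mp hr
  have hdvd := mul_dvd_mul (X_pow_dvd_baileyKernel_sub (R := ℤ⟦X⟧) (Nat.succ_le_of_lt hrN))
    (X_pow_dvd_partSeries (i := r + 1) oddWeight_zero)
  rw [← pow_add, show N - r.succ + 1 + (r + 1) = N + 1 by omega] at hdvd
  refine hdvd.trans (Dvd.intro_left (baileyAlpha ℤ⟦X⟧ r) ?_)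
  ring

end Weights

section Rank

theorem sum_map_pred_add_card (s : Multiset ℕ) (hs : ∀ i ∈ s, 0 < i) :
    (s.map (· - 1)).sum + Multiset.card s = s.sum := by
  induction s using Multiset.induction_on with
  | empty => simp
  | cons a s ih =>
    have htail := ih fun i hi => hs i (Multiset.mem_cons_of_mem hi)
    have ha := hs a (Multiset.mem_cons_self a s)
    simp only [Multiset.map_cons, Multiset.sum_cons, Multiset.card_cons]
    omega

theorem map_succ_filter_map_pred (s : Multiset ℕ) (hs : ∀ i ∈ s, 0 < i) :
    ((s.map (· - 1)).filter (· ≠ 0)).map (· + 1) + Multiset.replicate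
      (Multiset.card s - Multiset.card ((s.map (· - 1)).filter (· ≠ 0))) 1 = s := by
  induction s using Multiset.induction_on with
  | empty => simp
  | cons a s ih =>
    have htail := ih fun i hi => hs i (Multiset.mem_cons_of_mem hi)
    have ha := hs a (Multiset.mem_cons_self a s)
    have hcard : Multiset.card ((s.map (· - 1)).filter (· ≠ 0)) ≤ Multiset.card s := by
      simpa using Multiset.card_le_card (Multiset.filter_le (· ≠ 0) (s.map (· - 1)))
    rw [Multiset.map_cons, Multiset.card_cons]
    by_cases hpred : a - 1 = 0
    · obtain rfl : a = 1 := by omega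
      rw [Multiset.filter_cons_of_neg _ (by simp), Nat.sub_add_comm hcard,
        Multiset.replicate_succ, Multiset.add_cons, htail]
    · rw [Multiset.filter_cons_of_pos (p := (· ≠ 0)) _ hpred, Multiset.map_cons,
        Multiset.card_cons, Nat.add_sub_add_right, Multiset.cons_add, htail,
        Nat.sub_add_cancel ha]

theorem sup_filter_ne_zero (s : Multiset ℕ) : (s.filter (· ≠ 0)).sup = s.sup := by
  refine le_antisymm (Multiset.sup_mono (Multiset.filter_subset _ _))
    (Multiset.sup_le.mpr fun b hb => ?_)
  rcases eq_or_ne b 0 with rfl | hb0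
  · exact bot_le
  · exact Multiset.le_sup (Multiset.mem_filter.mpr ⟨hb, hb0⟩)

theorem erase_filter_ne_zero_cons (a : ℕ) (s : Multiset ℕ) :
    ((a ::ₘ s).filter (· ≠ 0)).erase a = s.filter (· ≠ 0) := by
  rcases eq_or_ne a 0 with rfl | ha
  · rw [Multiset.filter_cons_of_neg _ (by simp), Multiset.erase_of_notMem (by simp)]
  · rw [Multiset.filter_cons_of_pos (p := (· ≠ 0)) _ ha, Multiset.erase_cons_head]

variable {n n' : ℕ} {r : ℤ}

theorem le_largestPart (p : n.Partition) {i : ℕ} (hi : i ∈ p.parts) : i ≤ largestPart p :=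
  Multiset.le_sup hi

theorem largestPart_mem (p : n.Partition) (hp : p.parts ≠ 0) : largestPart p ∈ p.parts := by
  obtain ⟨i, hi, hmax⟩ := p.parts.toFinset.exists_max_image id (by simpa using hp)
  rw [Multiset.mem_toFinset] at hi
  have hle : largestPart p ≤ i :=
    Multiset.sup_le.mpr fun b hb => hmax b (Multiset.mem_toFinset.mpr hb)
  rwa [hle.antisymm (le_largestPart p hi)]

theorem cons_erase_largestPart (p : n.Partition) (hp : p.parts ≠ 0) :
    largestPart p ::ₘ p.parts.erase (largestPart p) = p.parts :=
  Multiset.cons_erase (largestPart_mem p hp)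

theorem largestPart_of_parts_eq_zero (p : n.Partition) (hp : p.parts = 0) :
    largestPart p = 0 := by
  rw [largestPart, hp, Multiset.sup_zero, Nat.bot_eq_zero]

theorem parts_ne_zero (p : n.Partition) (hn : n ≠ 0) : p.parts ≠ 0 := by
  intro hp
  exact hn (by simpa [hp] using p.parts_sum.symm)

theorem sum_erase_largestPart_add (p : n.Partition) :
    (p.parts.erase (largestPart p)).sum + largestPart p = n := by
  by_cases hp : p.parts = 0
  · rw [largestPart_of_parts_eq_zero p hp]
    simpa [hp] using p.parts_sum
  · rw [add_comm, ← Multiset.sum_cons, cons_erase_largestPart p hp, p.parts_sum]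

/-- The number of partitions of `n` with rank at least `r`. -/
def rankGe (r : ℤ) (n : ℕ) : ℕ := #{p : n.Partition | r ≤ rank p}

/-- The number of partitions of `n` with rank at most `r`. -/
def rankLe (r : ℤ) (n : ℕ) : ℕ := #{p : n.Partition | rank p ≤ r}

theorem sub_one_le_card_add (p : n.Partition) (hp : rank p ≤ r + 2) :
    ∀ i ∈ p.parts, (i : ℤ) - 1 ≤ (Multiset.card p.parts : ℤ) + r + 1 := by
  rw [rank] at hp
  intro i hi
  have := le_largestPart p hi
  omega

theorem card_add_nonneg (hr : 1 ≤ r ∨ r ≤ -3) (p : n.Partition) (hp : rank p ≤ r + 2) :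
    0 ≤ (Multiset.card p.parts : ℤ) + r + 1 := by
  by_cases hparts : p.parts = 0
  · simp only [rank, largestPart_of_parts_eq_zero p hparts, hparts, Multiset.card_zero] at hp ⊢
    omega
  · have hmem := largestPart_mem p hparts
    have hpos := p.parts_pos hmem
    have hle := sub_one_le_card_add p hp _ hmem
    omega

theorem card_erase_largestPart_le (hr : 1 ≤ r ∨ r ≤ -3) (p : n.Partition) (hp : r ≤ rank p) :
    (Multiset.card (p.parts.erase (largestPart p)) : ℤ) ≤ (largestPart p : ℤ) - r - 1 := by
  rw [rank] at hp
  by_cases hparts : p.parts = 0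
  · simp only [largestPart_of_parts_eq_zero p hparts, hparts, Multiset.card_zero,
      Multiset.erase_zero] at hp ⊢
    omega
  · have hcard := congrArg Multiset.card (cons_erase_largestPart p hparts)
    rw [Multiset.card_cons] at hcard
    omega

/-- Dyson's map: remove `1` from every part, and add a part that exceeds the former number of parts
by `r + 1`. -/
def dysonMap (hn : (n' : ℤ) = n + r + 1) (p : n.Partition)
    (hp : 0 ≤ (Multiset.card p.parts : ℤ) + r + 1) : n'.Partition :=
  Nat.Partition.ofSums n'
    (((Multiset.card p.parts : ℤ) + r + 1).toNat ::ₘ p.parts.map (· - 1)) (by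
      have hsum := sum_map_pred_add_card p.parts fun _ hi => p.parts_pos hi
      rw [p.parts_sum] at hsum
      rw [Multiset.sum_cons]
      omega)

/-- The inverse of Dyson's map: remove the largest part, add `1` to every other part, and add ones
until the number of parts is the removed part minus `r + 1`. -/
def dysonInv (hn : (n' : ℤ) = n + r + 1) (p : n'.Partition)
    (hp : (Multiset.card (p.parts.erase (largestPart p)) : ℤ) ≤ (largestPart p : ℤ) - r - 1) :
    n.Partition where
  parts := (p.parts.erase (largestPart p)).map (· + 1) + Multiset.replicate
    ((largestPart p : ℤ) - r - 1 - Multiset.card (p.parts.erase (largestPart p))).toNat 1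
  parts_pos := by
    intro i hi
    rw [Multiset.mem_add, Multiset.mem_map] at hi
    rcases hi with ⟨a, _, rfl⟩ | hi
    · exact a.succ_pos
    · rw [Multiset.eq_of_mem_replicate hi]; exact one_pos
  parts_sum := by
    have hsum := sum_erase_largestPart_add p
    rw [Multiset.sum_add, Multiset.sum_map_add, Multiset.sum_replicate]
    simp only [Multiset.map_id', Multiset.map_const', Multiset.sum_replicate, smul_eq_mul, mul_one]
    omega

theorem largestPart_dysonMap (hn : (n' : ℤ) = n + r + 1) (p : n.Partition)
    (hp : 0 ≤ (Multiset.card p.parts : ℤ) + r + 1)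
    (hle : ∀ i ∈ p.parts, (i : ℤ) - 1 ≤ (Multiset.card p.parts : ℤ) + r + 1) :
    largestPart (dysonMap hn p hp) = ((Multiset.card p.parts : ℤ) + r + 1).toNat := by
  rw [largestPart, dysonMap, Nat.Partition.ofSums_parts, sup_filter_ne_zero, Multiset.sup_cons,
    sup_eq_left, Multiset.sup_le]
  intro b hb
  obtain ⟨i, hi, rfl⟩ := Multiset.mem_map.mp hb
  have := hle i hi
  omega

theorem erase_parts_dysonMap (hn : (n' : ℤ) = n + r + 1) (p : n.Partition)
    (hp : 0 ≤ (Multiset.card p.parts : ℤ) + r + 1) :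
    (dysonMap hn p hp).parts.erase ((Multiset.card p.parts : ℤ) + r + 1).toNat =
      (p.parts.map (· - 1)).filter (· ≠ 0) := by
  rw [dysonMap, Nat.Partition.ofSums_parts, erase_filter_ne_zero_cons]

theorem card_parts_dysonMap_le (hn : (n' : ℤ) = n + r + 1) (p : n.Partition)
    (hp : 0 ≤ (Multiset.card p.parts : ℤ) + r + 1) :
    Multiset.card (dysonMap hn p hp).parts ≤ Multiset.card p.parts + 1 := by
  rw [dysonMap, Nat.Partition.ofSums_parts]
  refine (Multiset.card_le_card (Multiset.filter_le _ _)).trans ?_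
  rw [Multiset.card_cons, Multiset.card_map]

theorem card_parts_dysonInv (hn : (n' : ℤ) = n + r + 1) (p : n'.Partition)
    (hp : (Multiset.card (p.parts.erase (largestPart p)) : ℤ) ≤ (largestPart p : ℤ) - r - 1) :
    (Multiset.card (dysonInv hn p hp).parts : ℤ) = (largestPart p : ℤ) - r - 1 := by
  simp only [dysonInv, Multiset.card_add, Multiset.card_map, Multiset.card_replicate]
  omega

theorem largestPart_dysonInv_le (hn : (n' : ℤ) = n + r + 1) (p : n'.Partition)
    (hp : (Multiset.card (p.parts.erase (largestPart p)) : ℤ) ≤ (largestPart p : ℤ) - r - 1) :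
    largestPart (dysonInv hn p hp) ≤ largestPart p + 1 := by
  rw [largestPart, Multiset.sup_le]
  intro b hb
  rw [dysonInv, Multiset.mem_add, Multiset.mem_map] at hb
  rcases hb with ⟨a, ha, rfl⟩ | hb
  · exact Nat.succ_le_succ (le_largestPart p (Multiset.mem_of_mem_erase ha))
  · rw [Multiset.eq_of_mem_replicate hb]
    exact Nat.le_add_left 1 _

theorem filter_cons_map_pred_parts_dysonInv (hn : (n' : ℤ) = n + r + 1) (p : n'.Partition)
    (hp : (Multiset.card (p.parts.erase (largestPart p)) : ℤ) ≤ (largestPart p : ℤ) - r - 1) :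
    (largestPart p ::ₘ (dysonInv hn p hp).parts.map (· - 1)).filter (· ≠ 0) = p.parts := by
  simp only [dysonInv, Multiset.map_add, Multiset.map_map, Function.comp_def, Nat.add_sub_cancel,
    Multiset.map_id', Multiset.map_replicate, Nat.sub_self]
  have hzeros (c : ℕ) : (Multiset.replicate c 0).filter (· ≠ 0) = 0 :=
    Multiset.filter_eq_nil.mpr fun a ha => by simp [Multiset.eq_of_mem_replicate ha]
  rw [← Multiset.cons_add, Multiset.filter_add, hzeros, add_zero]
  by_cases hparts : p.parts = 0
  · simp [largestPart, hparts]
  · rw [cons_erase_largestPart p hparts, Multiset.filter_eq_self]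
    exact fun a ha => (p.parts_pos ha).ne'

theorem le_rank_dysonMap (hn : (n' : ℤ) = n + r + 1) (p : n.Partition)
    (hp : 0 ≤ (Multiset.card p.parts : ℤ) + r + 1) (hrank : rank p ≤ r + 2) :
    r ≤ rank (dysonMap hn p hp) := by
  have hlargest := largestPart_dysonMap hn p hp (sub_one_le_card_add p hrank)
  have hcard := card_parts_dysonMap_le hn p hp
  rw [rank]
  omega

theorem rank_dysonInv_le (hn : (n' : ℤ) = n + r + 1) (p : n'.Partition)
    (hp : (Multiset.card (p.parts.erase (largestPart p)) : ℤ) ≤ (largestPart p : ℤ) - r - 1) :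
    rank (dysonInv hn p hp) ≤ r + 2 := by
  have hlargest := largestPart_dysonInv_le hn p hp
  have hcard := card_parts_dysonInv hn p hp
  rw [rank]
  omega

theorem rankGe_eq_rankLe (hr : 1 ≤ r ∨ r ≤ -3) (hn : (n' : ℤ) = n + r + 1) :
    rankGe r n' = rankLe (r + 2) n := by
  symm
  refine Finset.card_bij'
    (fun p hp => dysonMap hn p (card_add_nonneg hr p (mem_filter.mp hp).2))
    (fun p hp => dysonInv hn p (card_erase_largestPart_le hr p (mem_filter.mp hp).2))
    (fun p hp => mem_filter.mpr ⟨mem_univ _, le_rank_dysonMap hn p _ (mem_filter.mp hp).2⟩)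
    (fun p hp => mem_filter.mpr ⟨mem_univ _, rank_dysonInv_le hn p _⟩) ?_ ?_
  · intro p hp
    have hcard := card_add_nonneg hr p (mem_filter.mp hp).2
    have hlargest := largestPart_dysonMap hn p hcard (sub_one_le_card_add p (mem_filter.mp hp).2)
    have hrestore := map_succ_filter_map_pred p.parts fun _ hi => p.parts_pos hi
    apply Nat.Partition.ext
    simp only [dysonInv]
    rw [hlargest, erase_parts_dysonMap hn p hcard]
    convert! hrestore using 3
    omega
  · intro p hp
    have hle := card_erase_largestPart_le hr p (mem_filter.mp hp).2
    have hcard := card_parts_dysonInv hn p hle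
    apply Nat.Partition.ext
    rw [dysonMap, Nat.Partition.ofSums_parts]
    refine Eq.trans ?_ (filter_cons_map_pred_parts_dysonInv hn p hle)
    congr 2
    omega

theorem rankGe_add_rankLe (r : ℤ) (n : ℕ) :
    rankGe r n + rankLe (r - 1) n = Fintype.card n.Partition := by
  rw [rankGe, rankLe, ← Finset.card_univ,
    ← card_filter_add_card_filter_not (s := (univ : Finset n.Partition)) (fun p => r ≤ rank p)]
  simp only [not_le, Int.le_sub_one_iff]

theorem abs_rank_lt (p : n.Partition) (hn : n ≠ 0) : |rank p| < n := by
  have hmem := largestPart_mem p (parts_ne_zero p hn)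
  have hpos := p.parts_pos hmem
  have hle : largestPart p ≤ n := Nat.Partition.le_of_mem_parts hmem
  have hcard : 0 < Multiset.card p.parts := Multiset.card_pos.mpr (parts_ne_zero p hn)
  have hsum := sum_map_pred_add_card p.parts fun _ hi => p.parts_pos hi
  rw [p.parts_sum] at hsum
  rw [rank, abs_lt]
  omega

theorem abs_rank_le (p : n.Partition) : |rank p| ≤ n := by
  rcases eq_or_ne n 0 with rfl | hn
  · simp [rank, largestPart]
  · exact (abs_rank_lt p hn).le

theorem abs_rank_lt_of_le (p : n.Partition) {r : ℕ} (hr : r ≠ 0) (h : n ≤ r) : |rank p| < r := by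
  rcases eq_or_ne n 0 with rfl | hn
  · simpa [rank, largestPart] using Nat.pos_of_ne_zero hr
  · exact (abs_rank_lt p hn).trans_le (by exact_mod_cast h)

/-- The generating function of the partitions with rank at least `r`. -/
noncomputable def rankGeSeries (r : ℕ) : ℤ⟦X⟧ := PowerSeries.mk fun n => (rankGe r n : ℤ)

/-- The generating function of the partitions with rank at most `-r`. -/
noncomputable def rankLeSeries (r : ℕ) : ℤ⟦X⟧ := PowerSeries.mk fun n => (rankLe (-r) n : ℤ)

theorem rankGeSeries_eq {r : ℕ} (hr : r ≠ 0) :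
    rankGeSeries r = X ^ (r + 1) * (partitionSeries ℤ - rankGeSeries (r + 3)) := by
  ext n
  rw [coeff_X_pow_mul']
  split_ifs with h
  · obtain ⟨m, rfl⟩ := Nat.exists_eq_add_of_le' h
    have hdyson := rankGe_eq_rankLe (n := m) (n' := m + (r + 1)) (r := r) (by omega)
      (by push_cast; ring)
    have hcompl := rankGe_add_rankLe (r + 3) m
    rw [show (r : ℤ) + 3 - 1 = r + 2 by ring, ← hdyson] at hcompl
    simp only [rankGeSeries, partitionSeries, coeff_mk, map_sub, Nat.add_sub_cancel, ← hcompl]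
    push_cast
    ring
  · simp only [rankGeSeries, coeff_mk, Nat.cast_eq_zero, rankGe, card_eq_zero,
      filter_eq_empty_iff, mem_univ, true_imp_iff, not_le]
    exact fun p => lt_of_abs_lt (abs_rank_lt_of_le p hr (by omega))

theorem rankLeSeries_eq {r : ℕ} (hr : r ≠ 0) :
    rankLeSeries r = X ^ (r + 1) * (partitionSeries ℤ - rankLeSeries (r + 3)) := by
  ext n
  rw [coeff_X_pow_mul']
  split_ifs with h
  · obtain ⟨m, rfl⟩ := Nat.exists_eq_add_of_le' h
    have hdyson := rankGe_eq_rankLe (n := m + (r + 1)) (n' := m) (r := -r - 2) (by omega)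
      (by push_cast; ring)
    have hcompl := rankGe_add_rankLe (-r - 2) m
    rw [show -(r : ℤ) - 2 - 1 = -(r + 3) by ring, hdyson, sub_add_cancel] at hcompl
    simp only [rankLeSeries, partitionSeries, coeff_mk, map_sub, Nat.add_sub_cancel, ← hcompl]
    push_cast
    ring
  · simp only [rankLeSeries, coeff_mk, Nat.cast_eq_zero, rankLe, card_eq_zero,
      filter_eq_empty_iff, mem_univ, true_imp_iff, not_le]
    exact fun p => neg_lt_of_abs_lt (abs_rank_lt_of_le p hr (by omega))

end Rank

section Durfee

open scoped PowerSeries.WithPiTopology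

/-- The term `q ^ (w (w + m) + a w) / ((q)_w (q)_{w + m})` of the series `durfee m a`. -/
noncomputable def durfeeTerm (m a w : ℕ) : ℤ⟦X⟧ :=
  X ^ (w * (w + m) + a * w) * (qInv ℤ w * qInv ℤ (w + m))

/-- The series `∑ w, q ^ (w (w + m) + a w) / ((q)_w (q)_{w + m})`. For `a = 0`, its terms count
partitions by the largest `w` such that `w` parts are at least `w + m`. -/
noncomputable def durfee (m a : ℕ) : ℤ⟦X⟧ := ∑' w, durfeeTerm m a w

theorem X_pow_dvd_durfeeTerm (m a w : ℕ) : X ^ w ∣ durfeeTerm m a w := by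
  refine Dvd.dvd.mul_right (pow_dvd_pow _ ?_) _
  nlinarith [Nat.zero_le (w * m), Nat.zero_le (a * w), Nat.le_mul_self w]

theorem summable_durfeeTerm (m a : ℕ) : Summable (durfeeTerm m a) :=
  summable_of_X_pow_dvd (X_pow_dvd_durfeeTerm m a)

theorem coeff_mul_durfee (f : ℤ⟦X⟧) (m a n : ℕ) :
    coeff n (f * durfee m a) = ∑ w ∈ range (n + 1), coeff n (f * durfeeTerm m a w) := by
  rw [durfee, ← (summable_durfeeTerm m a).tsum_mul_left,
    coeff_tsum_of_X_pow_dvd fun w => (X_pow_dvd_durfeeTerm m a w).mul_left f]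

theorem durfee_sub (m a : ℕ) :
    durfee m a - durfee m (a + 1) = X ^ (m + 1 + a) * durfee (m + 1) (a + 1) := by
  have hzero : durfeeTerm m a 0 - durfeeTerm m (a + 1) 0 = 0 := by simp [durfeeTerm]
  have hsummable := (summable_durfeeTerm m a).sub (summable_durfeeTerm m (a + 1))
  rw [durfee, durfee, ← (summable_durfeeTerm m a).tsum_sub (summable_durfeeTerm m (a + 1)),
    hsummable.tsum_eq_zero_add, hzero, zero_add, durfee,
    ← (summable_durfeeTerm _ _).tsum_mul_left]
  refine tsum_congr fun w => ?_
  rw [durfeeTerm, durfeeTerm, durfeeTerm, ← one_sub_mul_qInv_succ w,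
    show w + (m + 1) = w + 1 + m by ring]
  ring

theorem durfee_succ_sub (m a : ℕ) :
    durfee (m + 1) a - X ^ (m + 1) * durfee (m + 1) (a + 1) = durfee m (a + 1) := by
  rw [durfee, durfee, ← (summable_durfeeTerm _ _).tsum_mul_left,
    ← (summable_durfeeTerm _ _).tsum_sub ((summable_durfeeTerm _ _).mul_left _), durfee]
  refine tsum_congr fun w => ?_
  rw [durfeeTerm, durfeeTerm, durfeeTerm, ← one_sub_mul_qInv_succ (w + m), ← add_assoc]
  ring

theorem durfee_add_zero_right (m j : ℕ) : durfee (m + j) 0 = durfee m 0 := by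
  induction j with
  | zero => rfl
  | succ j ih =>
    rw [← add_assoc, ← ih]
    linear_combination durfee_succ_sub (m + j) 0 - durfee_sub (m + j) 0

theorem X_pow_dvd_durfee_sub (m a : ℕ) : X ^ (m + 1) ∣ durfee m a - qInv ℤ m := by
  rw [durfee, (summable_durfeeTerm m a).tsum_eq_zero_add,
    show durfeeTerm m a 0 = qInv ℤ m by simp [durfeeTerm], add_sub_cancel_left]
  refine X_pow_dvd_tsum fun w => Dvd.dvd.mul_right (pow_dvd_pow _ ?_) _
  nlinarith [Nat.zero_le (w * (w + m)), Nat.zero_le (a * (w + 1))]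

theorem durfee_zero_right (m : ℕ) : durfee m 0 = partitionSeries ℤ := by
  -- `durfee m 0` does not depend on `m`, so both sides can be compared with `1 / (q)_{m + n}`.
  refine eq_of_forall_X_pow_dvd_sub fun n => ?_
  have hdvd := dvd_sub (X_pow_dvd_durfee_sub (m + n) 0)
    (X_pow_dvd_partitionSeries_sub (R := ℤ) (m + n))
  rw [sub_sub_sub_cancel_right, durfee_add_zero_right] at hdvd
  exact (pow_dvd_pow _ (by omega)).trans hdvd

/-- The generating function of the partitions with crank at least `r`, for `r ≥ 1`, with the values
of `crankCount` as a convention for the partition of `1`. -/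
noncomputable def crankGeSeries (r : ℕ) : ℤ⟦X⟧ := X ^ r * durfee r 1

theorem crankGeSeries_eq (r : ℕ) :
    crankGeSeries r = X ^ r * (partitionSeries ℤ - crankGeSeries (r + 1)) := by
  rw [crankGeSeries, crankGeSeries, ← durfee_zero_right r]
  linear_combination -X ^ r * durfee_sub r 0

theorem crankGeSeries_sub (m : ℕ) :
    crankGeSeries m - crankGeSeries (m + 1) = (1 - X) * X ^ m * durfee m 2 := by
  rw [crankGeSeries, crankGeSeries]
  linear_combination X ^ m * durfee_sub m 1 - X ^ (m + 1) * durfee_succ_sub m 1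

end Durfee

section LargeParts

open scoped PowerSeries.WithPiTopology

/-- The term `z ^ v q ^ (v (w + 1)) / (q)_v` of `largePartSeries w`. -/
noncomputable def largePartTerm (w v : ℕ) : ℤ⟦X⟧⟦X⟧ :=
  C (X ^ v) * (X ^ (v * (w + 1)) * qInv ℤ⟦X⟧ v)

/-- The series `∑ v, z ^ v q ^ (v (w + 1)) / (q)_v`, where `z` is the inner and `q` the outer
variable. By Euler's identity it is the generating function of the partitions into parts larger
than `w`, with `z` marking the number of parts. -/
noncomputable def largePartSeries (w : ℕ) : ℤ⟦X⟧⟦X⟧ := ∑' v, largePartTerm w v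

theorem X_pow_dvd_largePartTerm (w v : ℕ) : X ^ v ∣ largePartTerm w v :=
  ((pow_dvd_pow X (Nat.le_mul_of_pos_right v w.succ_pos)).mul_right _).mul_left _

theorem summable_largePartTerm (w : ℕ) : Summable (largePartTerm w) :=
  summable_of_X_pow_dvd (X_pow_dvd_largePartTerm w)

theorem one_sub_mul_largePartSeries (w : ℕ) :
    (1 - C X * X ^ (w + 1)) * largePartSeries w = largePartSeries (w + 1) := by
  have hdiff : largePartSeries w - largePartSeries (w + 1) =
      (C X * X ^ (w + 1)) * largePartSeries w := by
    have hzero : largePartTerm w 0 - largePartTerm (w + 1) 0 = 0 := by simp [largePartTerm]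
    have hsummable := (summable_largePartTerm w).sub (summable_largePartTerm (w + 1))
    rw [largePartSeries, largePartSeries,
      ← (summable_largePartTerm w).tsum_sub (summable_largePartTerm (w + 1)),
      hsummable.tsum_eq_zero_add, hzero, zero_add, ← (summable_largePartTerm w).tsum_mul_left]
    refine tsum_congr fun v => ?_
    rw [largePartTerm, largePartTerm, largePartTerm, ← one_sub_mul_qInv_succ v, map_pow, map_pow]
    ring
  linear_combination hdiff

theorem prod_Ioc_partSeries_mul_largePartSeries {w N : ℕ} (h : w ≤ N) :
    (∏ i ∈ Ioc w N, partSeries i fun c => (X : ℤ⟦X⟧) ^ c) * largePartSeries N =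
      largePartSeries w := by
  induction N, h using Nat.le_induction with
  | base => simp
  | succ N hN ih =>
    rw [prod_Ioc_succ_top hN, ← ih, ← one_sub_mul_largePartSeries]
    linear_combination (∏ i ∈ Ioc w N, partSeries i fun c => (X : ℤ⟦X⟧) ^ c) *
      largePartSeries N *
        one_sub_C_mul_X_pow_mul_partSeries (i := N + 1) N.succ_ne_zero (X : ℤ⟦X⟧)

theorem X_pow_dvd_largePartSeries_sub_one (N : ℕ) : X ^ (N + 1) ∣ largePartSeries N - 1 := by
  rw [largePartSeries, (summable_largePartTerm N).tsum_eq_zero_add,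
    show largePartTerm N 0 = 1 by simp [largePartTerm], add_sub_cancel_left]
  refine X_pow_dvd_tsum fun v => Dvd.dvd.mul_left (Dvd.dvd.mul_right (pow_dvd_pow _ ?_) _) _
  nlinarith [Nat.zero_le (v * N)]

theorem X_pow_dvd_prod_Ioc_partSeries_sub {w N : ℕ} (h : w ≤ N) :
    X ^ (N + 1) ∣ (∏ i ∈ Ioc w N, partSeries i fun c => (X : ℤ⟦X⟧) ^ c) - largePartSeries w := by
  rw [← prod_Ioc_partSeries_mul_largePartSeries h, ← mul_one_sub, ← neg_sub, mul_neg, dvd_neg]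
  exact (X_pow_dvd_largePartSeries_sub_one N).mul_left _

theorem coeff_coeff_mul_largePartTerm (f : ℤ⟦X⟧) (w u v n : ℕ) :
    coeff v (coeff n (PowerSeries.map C f * largePartTerm w u)) =
      if v = u then coeff n (f * (X ^ (u * (w + 1)) * qInv ℤ u)) else 0 := by
  have hmap : PowerSeries.map C f * largePartTerm w u = C (X ^ u) *
      PowerSeries.map C (f * (X ^ (u * (w + 1)) * qInv ℤ u)) := by
    rw [largePartTerm, map_mul, map_mul, map_pow (PowerSeries.map C), map_X, map_qInv]
    ring
  rw [hmap, coeff_C_mul, coeff_map, mul_comm, coeff_C_mul, coeff_X_pow, mul_ite, mul_one, mul_zero]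

theorem coeff_coeff_mul_largePartSeries (f : ℤ⟦X⟧) (w v n : ℕ) :
    coeff v (coeff n (PowerSeries.map C f * largePartSeries w)) =
      coeff n (f * (X ^ (v * (w + 1)) * qInv ℤ v)) := by
  rw [largePartSeries, ← (summable_largePartTerm w).tsum_mul_left,
    coeff_tsum_of_X_pow_dvd fun u => (X_pow_dvd_largePartTerm w u).mul_left _, map_sum,
    sum_congr rfl fun u _ => coeff_coeff_mul_largePartTerm f w u v n, sum_ite_eq, ite_eq_left_iff]
  intro hv
  have hdvd : X ^ v ∣ f * (X ^ (v * (w + 1)) * qInv ℤ v) :=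
    ((pow_dvd_pow X (Nat.le_mul_of_pos_right v w.succ_pos)).mul_right _).mul_left f
  exact (X_pow_dvd_iff.mp hdvd n (by simpa using hv)).symm

end LargeParts

section CrankCount

theorem prod_Icc_one_eq_mul_prod_Ioc_mul_prod_Ioc {M : Type*} [CommMonoid M] (f : ℕ → M)
    {w N : ℕ} (hw : 1 ≤ w) (h : w ≤ N) :
    ∏ i ∈ Icc 1 N, f i = f 1 * (∏ i ∈ Ioc 1 w, f i) * ∏ i ∈ Ioc w N, f i := by
  rw [mul_assoc, prod_Ioc_consecutive f hw h, mul_prod_Ioc_eq_prod_Icc (hw.trans h)]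

theorem prod_Ioc_one_partSeries (R : Type*) [CommRing R] {w : ℕ} (hw : 1 ≤ w) :
    ∏ i ∈ Ioc 1 w, partSeries i (fun _ => (1 : R)) = (1 - X) * qInv R w := by
  have hone := one_sub_X_pow_mul_partSeries (R := R) one_ne_zero
  rw [pow_one] at hone
  rw [qInv_eq_prod_Icc, ← mul_prod_Ioc_eq_prod_Icc hw, ← mul_assoc, hone, one_mul]

theorem card_filter_lt_eq_sum {n N : ℕ} (p : n.Partition) (hN : n ≤ N) (w : ℕ) :
    Multiset.card (p.parts.filter (w < ·)) = ∑ i ∈ Ioc w N, p.parts.count i := by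
  rw [← Multiset.sum_count_eq_card (s := Ioc w N)]
  · exact sum_congr rfl fun i hi => Multiset.count_filter_of_pos (mem_Ioc.mp hi).1
  · intro a ha
    obtain ⟨hmem, hlt⟩ := Multiset.mem_filter.mp ha
    exact mem_Ioc.mpr ⟨hlt, (Nat.Partition.le_of_mem_parts hmem).trans hN⟩

theorem card_parts_le {n : ℕ} (p : n.Partition) : Multiset.card p.parts ≤ n := by
  have hsum := sum_map_pred_add_card p.parts fun _ hi => p.parts_pos hi
  rw [p.parts_sum] at hsum
  exact le_of_add_le_right hsum.le

/-- The weight of a part `i` occurring `c` times that singles out the partitions with `w` ones and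
counts their parts larger than `w` in the exponent of the variable. -/
noncomputable def crankWeight (w i c : ℕ) : ℤ⟦X⟧ :=
  if i = 1 then (if c = w then 1 else 0) else if i ≤ w then 1 else X ^ c

theorem crankWeight_one (w : ℕ) : crankWeight w 1 = fun c => if c = w then 1 else 0 :=
  funext fun _ => if_pos rfl

theorem crankWeight_of_mem_Ioc_one {w i : ℕ} (hi : i ∈ Ioc 1 w) :
    crankWeight w i = fun _ => 1 := by
  obtain ⟨hlt, hle⟩ := mem_Ioc.mp hi
  exact funext fun c => by rw [crankWeight, if_neg hlt.ne', if_pos hle]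

theorem crankWeight_of_mem_Ioc {w N i : ℕ} (hw : 1 ≤ w) (hi : i ∈ Ioc w N) :
    crankWeight w i = fun c => X ^ c := by
  have hlt := (mem_Ioc.mp hi).1
  exact funext fun c => by rw [crankWeight, if_neg (hw.trans_lt hlt).ne', if_neg hlt.not_ge]

theorem prod_crankWeight_count {w n N : ℕ} (hw : 1 ≤ w) (hwN : w ≤ N) (hnN : n ≤ N)
    (p : n.Partition) :
    ∏ i ∈ Icc 1 N, crankWeight w i (p.parts.count i) =
      if p.parts.count 1 = w then X ^ Multiset.card (p.parts.filter (w < ·)) else 0 := by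
  rw [prod_Icc_one_eq_mul_prod_Ioc_mul_prod_Ioc _ hw hwN, crankWeight_one,
    prod_congr rfl fun i hi => congrFun (crankWeight_of_mem_Ioc_one hi) _,
    prod_congr rfl fun i hi => congrFun (crankWeight_of_mem_Ioc hw hi) _,
    prod_const_one, mul_one, prod_pow_eq_pow_sum, ← card_filter_lt_eq_sum p hnN, ite_mul, one_mul,
    zero_mul]

theorem prod_partSeries_crankWeight {w N : ℕ} (hw : 1 ≤ w) (hwN : w ≤ N) :
    ∏ i ∈ Icc 1 N, partSeries i (crankWeight w i) =
      PowerSeries.map C ((1 - X) * X ^ w * qInv ℤ w) *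
        ∏ i ∈ Ioc w N, partSeries i (fun c => (X : ℤ⟦X⟧) ^ c) := by
  rw [prod_Icc_one_eq_mul_prod_Ioc_mul_prod_Ioc _ hw hwN, crankWeight_one,
    partSeries_single one_ne_zero,
    prod_congr rfl fun i hi => congrArg (partSeries i) (crankWeight_of_mem_Ioc_one hi),
    prod_congr rfl fun i hi => congrArg (partSeries i) (crankWeight_of_mem_Ioc hw hi),
    prod_Ioc_one_partSeries _ hw, map_mul, map_mul, map_sub, map_one, map_pow, map_X, map_qInv]
  ring

theorem sum_crankWeight_eq_coeff {w : ℕ} (hw : 1 ≤ w) (n : ℕ) :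
    ∑ p : n.Partition,
        (if p.parts.count 1 = w then X ^ Multiset.card (p.parts.filter (w < ·)) else 0) =
      coeff n (PowerSeries.map C ((1 - X) * X ^ w * qInv ℤ w) * largePartSeries w) := by
  have hnN : n ≤ n + w := Nat.le_add_right n w
  have hwN : w ≤ n + w := Nat.le_add_left w n
  rw [← sum_congr rfl fun p _ => prod_crankWeight_count hw hwN hnN p,
    sum_prod_count_Icc_eq_coeff _ hnN]
  refine coeff_eq_of_X_pow_dvd_sub (m := n + w + 1) ?_ (Nat.lt_succ_of_le hnN)
  rw [prod_partSeries_crankWeight hw hwN, ← mul_sub]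
  exact (X_pow_dvd_prod_Ioc_partSeries_sub hwN).mul_left _

theorem card_count_one_eq_and_card_filter_eq {w : ℕ} (hw : 1 ≤ w) (v n : ℕ) :
    (#{p : n.Partition | p.parts.count 1 = w ∧ Multiset.card (p.parts.filter (w < ·)) = v} : ℤ) =
      coeff n ((1 - X) * X ^ (w + v * (w + 1)) * (qInv ℤ w * qInv ℤ v)) := by
  have hcoeff := congrArg (coeff v) (sum_crankWeight_eq_coeff hw n)
  rw [coeff_coeff_mul_largePartSeries, map_sum] at hcoeff
  rw [show (1 - X) * X ^ (w + v * (w + 1)) * (qInv ℤ w * qInv ℤ v) =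
    (1 - X) * X ^ w * qInv ℤ w * (X ^ (v * (w + 1)) * qInv ℤ v) by ring, ← hcoeff, card_filter]
  push_cast
  refine sum_congr rfl fun p _ => ?_
  simp only [ite_and, apply_ite (coeff v), coeff_X_pow, map_zero, eq_comm (a := v)]

theorem forall_mem_Ioc_one_iff {n : ℕ} (p : n.Partition) (L : ℕ) :
    (∀ i ∈ p.parts, i ∈ Ioc 1 L) ↔ p.parts.count 1 = 0 ∧ largestPart p ≤ L := by
  rw [Multiset.count_eq_zero, largestPart, Multiset.sup_le]
  refine ⟨fun h => ⟨fun hone => absurd (mem_Ioc.mp (h 1 hone)).1 (lt_irrefl 1),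
    fun i hi => (mem_Ioc.mp (h i hi)).2⟩, fun ⟨hone, hle⟩ i hi => mem_Ioc.mpr ⟨?_, hle i hi⟩⟩
  exact lt_of_le_of_ne (p.parts_pos hi) fun h => hone (h ▸ hi)

theorem card_count_one_eq_zero_and_largestPart_le {n : ℕ} (hn : n ≠ 1) (L : ℕ) :
    (#{p : n.Partition | p.parts.count 1 = 0 ∧ largestPart p ≤ L} : ℤ) =
      coeff n ((1 - X) * qInv ℤ L) := by
  have hcount := sum_prod_count_eq_coeff (fun _ _ => (1 : ℤ)) (s := Ioc 1 L) (by simp) n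
  simp only [prod_const_one, sum_const, nsmul_one, forall_mem_Ioc_one_iff] at hcount
  rw [hcount]
  rcases Nat.eq_zero_or_pos L with rfl | hL
  · simp [coeff_X, hn]
  · rw [prod_Ioc_one_partSeries ℤ hL]

theorem card_count_one_eq_zero_and_largestPart_eq {n : ℕ} (hn : n ≠ 1) {L : ℕ} (hL : L ≠ 0) :
    (#{p : n.Partition | p.parts.count 1 = 0 ∧ largestPart p = L} : ℤ) =
      coeff n ((1 - X) * X ^ L * qInv ℤ L) := by
  obtain ⟨L, rfl⟩ := Nat.exists_eq_succ_of_ne_zero hL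
  have hsplit : #{p : n.Partition | p.parts.count 1 = 0 ∧ largestPart p ≤ L + 1} =
      #{p : n.Partition | p.parts.count 1 = 0 ∧ largestPart p ≤ L} +
        #{p : n.Partition | p.parts.count 1 = 0 ∧ largestPart p = L + 1} := by
    simp only [Nat.le_succ_iff, and_or_left, filter_or]
    refine card_union_of_disjoint (disjoint_filter.mpr fun p _ hle heq => ?_)
    have := hle.2
    have := heq.2
    omega
  have hcast := congrArg (Nat.cast (R := ℤ)) hsplit
  rw [Nat.cast_add, card_count_one_eq_zero_and_largestPart_le hn,
    card_count_one_eq_zero_and_largestPart_le hn] at hcast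
  rw [← sub_eq_iff_eq_add'.mpr hcast, ← map_sub, ← one_sub_mul_qInv_succ L, Nat.succ_eq_add_one]
  congr 1
  ring

theorem card_crank_eq_and_count_one_eq {n m : ℕ} (hn : n ≠ 1) (hm : m ≠ 0) (w : ℕ) :
    (#{p : n.Partition | crank p = m ∧ p.parts.count 1 = w} : ℤ) =
      coeff n ((1 - X) * X ^ m * durfeeTerm m 2 w) := by
  rcases Nat.eq_zero_or_pos w with rfl | hw
  · have hcrank (p : n.Partition) : crank p = m ∧ p.parts.count 1 = 0 ↔
        p.parts.count 1 = 0 ∧ largestPart p = m := by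
      rw [and_comm, and_congr_right_iff]
      intro hone
      rw [crank, if_pos hone, Nat.cast_inj]
    simp only [hcrank]
    rw [card_count_one_eq_zero_and_largestPart_eq hn hm]
    simp [durfeeTerm]
  · have hcrank (p : n.Partition) : crank p = m ∧ p.parts.count 1 = w ↔
        p.parts.count 1 = w ∧ Multiset.card (p.parts.filter (w < ·)) = w + m := by
      rw [and_comm, and_congr_right_iff]
      rintro rfl
      rw [crank, if_neg hw.ne']
      omega
    simp only [hcrank]
    rw [card_count_one_eq_and_card_filter_eq hw, durfeeTerm]
    congr 1
    ring

theorem card_crank_eq_natCast {n m : ℕ} (hn : n ≠ 1) (hm : m ≠ 0) :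
    (#{p : n.Partition | crank p = m} : ℤ) = coeff n ((1 - X) * X ^ m * durfee m 2) := by
  rw [card_eq_sum_card_fiberwise (f := fun p : n.Partition => p.parts.count 1)
      (t := range (n + 1)) fun p _ => mem_coe.mpr (mem_range.mpr
        (Nat.lt_succ_of_le ((Multiset.count_le_card _ _).trans (card_parts_le p)))),
    coeff_mul_durfee, Nat.cast_sum]
  exact sum_congr rfl fun w _ => by
    rw [filter_filter, card_crank_eq_and_count_one_eq hn hm]

theorem card_crank_eq_neg_and_card_filter_eq {n m : ℕ} (hm : m ≠ 0) (v : ℕ) :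
    (#{p : n.Partition | crank p = -m ∧
        Multiset.card (p.parts.filter (p.parts.count 1 < ·)) = v} : ℤ) =
      coeff n ((1 - X) * X ^ m * durfeeTerm m 2 v) := by
  have hcrank (p : n.Partition) :
      crank p = -m ∧ Multiset.card (p.parts.filter (p.parts.count 1 < ·)) = v ↔
        p.parts.count 1 = v + m ∧ Multiset.card (p.parts.filter (v + m < ·)) = v := by
    constructor
    · rintro ⟨hcrank, hlarge⟩
      have hone : p.parts.count 1 = v + m := by
        rw [crank] at hcrank
        split_ifs at hcrank <;> omega
      exact ⟨hone, hone ▸ hlarge⟩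
    · rintro ⟨hone, hlarge⟩
      rw [crank, hone, if_neg (by omega)]
      exact ⟨by omega, hlarge⟩
  simp only [hcrank]
  rw [card_count_one_eq_and_card_filter_eq (by omega), durfeeTerm, mul_comm (qInv ℤ (v + m))]
  congr 1
  ring

theorem card_crank_eq_neg_natCast {m : ℕ} (hm : m ≠ 0) (n : ℕ) :
    (#{p : n.Partition | crank p = -m} : ℤ) = coeff n ((1 - X) * X ^ m * durfee m 2) := by
  rw [card_eq_sum_card_fiberwise
      (f := fun p : n.Partition => Multiset.card (p.parts.filter (p.parts.count 1 < ·)))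
      (t := range (n + 1)) fun p _ => mem_coe.mpr (mem_range.mpr (Nat.lt_succ_of_le
        ((Multiset.card_le_card (Multiset.filter_le _ _)).trans (card_parts_le p)))),
    coeff_mul_durfee, Nat.cast_sum]
  exact sum_congr rfl fun v _ => by rw [filter_filter, card_crank_eq_neg_and_card_filter_eq hm]

theorem constantCoeff_qInv (n : ℕ) : constantCoeff (qInv ℤ n) = 1 := by
  simp [qInv, map_prod, ← coeff_zero_eq_constantCoeff_apply, coeff_partSeries]

theorem coeff_one_mul_durfee {m : ℕ} (hm : m ≠ 0) :
    coeff 1 ((1 - X) * X ^ m * durfee m 2) = if m = 1 then 1 else 0 := by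
  rw [mul_comm (1 - X : ℤ⟦X⟧), mul_assoc, coeff_X_pow_mul']
  rcases Nat.lt_or_ge 1 m with h | h
  · rw [if_neg h.not_ge, if_neg h.ne']
  · obtain rfl : m = 1 := by omega
    rw [if_pos le_rfl, if_pos rfl, Nat.sub_self, coeff_mul_durfee]
    simp [durfeeTerm, constantCoeff_qInv]

theorem crankCount_natCast {m : ℕ} (hm : m ≠ 0) (n : ℕ) :
    crankCount m n = coeff n (crankGeSeries m - crankGeSeries (m + 1)) := by
  rw [crankGeSeries_sub, crankCount]
  rcases eq_or_ne n 1 with rfl | hn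
  · have hneg : (m : ℤ) ≠ -1 := by omega
    rw [if_pos rfl, coeff_one_mul_durfee hm, if_neg hneg, if_neg (Nat.cast_ne_zero.mpr hm)]
    exact if_congr Nat.cast_eq_one rfl rfl
  · rw [if_neg hn, card_crank_eq_natCast hn hm]

theorem crankCount_neg_natCast {m : ℕ} (hm : m ≠ 0) (n : ℕ) :
    crankCount (-m) n = coeff n (crankGeSeries m - crankGeSeries (m + 1)) := by
  rw [crankGeSeries_sub, crankCount]
  rcases eq_or_ne n 1 with rfl | hn
  · have hzero : -(m : ℤ) ≠ 0 := by omega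
    have hone : -(m : ℤ) ≠ 1 := by omega
    rw [if_pos rfl, coeff_one_mul_durfee hm, if_neg hzero, if_neg hone]
    exact if_congr (by omega) rfl rfl
  · rw [if_neg hn, card_crank_eq_neg_natCast hm]

theorem sum_coeff_crankGeSeries_sub (r n : ℕ) :
    ∑ m ∈ Icc r n, coeff n (crankGeSeries m - crankGeSeries (m + 1)) =
      coeff n (crankGeSeries r) := by
  have hzero (m : ℕ) (hm : n < m) : coeff n (crankGeSeries m) = 0 :=
    X_pow_dvd_iff.mp (dvd_mul_right _ _) n hm
  rcases Nat.lt_or_ge n r with h | h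
  · rw [Icc_eq_empty_of_lt h, sum_empty, hzero r h]
  · have htelescope := sum_Icc_sub h fun m => coeff n (crankGeSeries m)
    rw [hzero (n + 1) n.lt_succ_self, zero_sub] at htelescope
    rw [← neg_eq_iff_eq_neg.mpr htelescope, ← sum_neg_distrib]
    exact sum_congr rfl fun m _ => by rw [map_sub, neg_sub]

theorem sum_crankCount {r : ℕ} (hr : r ≠ 0) (n : ℕ) :
    ∑ m ∈ Icc r n, crankCount m n = coeff n (crankGeSeries r) := by
  rw [← sum_coeff_crankGeSeries_sub]
  refine sum_congr rfl fun m hm => crankCount_natCast ?_ n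
  exact ((Nat.pos_of_ne_zero hr).trans_le (mem_Icc.mp hm).1).ne'

theorem sum_crankCount_neg {r : ℕ} (hr : r ≠ 0) (n : ℕ) :
    ∑ m ∈ Icc r n, crankCount (-m) n = coeff n (crankGeSeries r) := by
  rw [← sum_coeff_crankGeSeries_sub]
  refine sum_congr rfl fun m hm => crankCount_neg_natCast ?_ n
  exact ((Nat.pos_of_ne_zero hr).trans_le (mem_Icc.mp hm).1).ne'

end CrankCount

section Compositions

theorem sum_composition_eq_sum_cons {M : Type*} [AddCommMonoid M] (F : List ℕ → M) {k : ℕ}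
    (hk : k ≠ 0) :
    ∑ c : Composition k, F c.blocks =
      ∑ x ∈ Icc 1 k, ∑ c : Composition (k - x), F (x :: c.blocks) := by
  rw [sum_sigma']
  symm
  refine sum_bij (fun y hy => (⟨y.1 :: y.2.blocks, ?_, ?_⟩ : Composition k))
    (fun _ _ => mem_univ _) ?_ ?_ (fun _ _ => rfl)
  · intro i hi
    rcases List.mem_cons.mp hi with rfl | hi
    · exact (mem_Icc.mp (mem_sigma.mp hy).1).1
    · exact y.2.blocks_pos hi
  · rw [List.sum_cons, y.2.blocks_sum,
      Nat.add_sub_cancel' (mem_Icc.mp (mem_sigma.mp hy).1).2]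
  · rintro ⟨x, c⟩ _ ⟨x', c'⟩ _ h
    obtain ⟨rfl, hblocks⟩ : x = x' ∧ c.blocks = c'.blocks :=
      List.cons.inj (congrArg Composition.blocks h)
    rw [Composition.ext hblocks]
  · rintro ⟨_ | ⟨x, l⟩, hpos, hsum⟩ _
    · exact absurd hsum.symm hk
    · rw [List.sum_cons] at hsum
      have hx : x ∈ Icc 1 k := mem_Icc.mpr ⟨hpos List.mem_cons_self, by omega⟩
      exact ⟨⟨x, ⟨l, fun hi => hpos (List.mem_cons_of_mem _ hi), by omega⟩⟩,
        mem_sigma.mpr ⟨hx, mem_univ _⟩, rfl⟩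

/-- The strictly increasing tuples of length `r` with entries in `[a, m]`. -/
def increasingTuples (r a m : ℕ) : Finset (Fin r → ℕ) :=
  (Fintype.piFinset fun _ : Fin r => Icc a m).filter fun j => ∀ i i' : Fin r, i < i' → j i < j i'

theorem mem_increasingTuples {r a m : ℕ} {j : Fin r → ℕ} :
    j ∈ increasingTuples r a m ↔ (∀ i, j i ∈ Icc a m) ∧ StrictMono j := by
  rw [increasingTuples, mem_filter, Fintype.mem_piFinset]
  rfl

theorem strictMono_cons_iff {r x : ℕ} {j : Fin r → ℕ} :
    StrictMono (Fin.cons x j : Fin (r + 1) → ℕ) ↔ (∀ i, x < j i) ∧ StrictMono j := by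
  simp [StrictMono, Fin.forall_fin_succ]

theorem cons_mem_increasingTuples {r a m x : ℕ} {j : Fin r → ℕ} :
    (Fin.cons x j : Fin (r + 1) → ℕ) ∈ increasingTuples (r + 1) a m ↔
      x ∈ Icc a m ∧ j ∈ increasingTuples r (x + 1) m := by
  simp only [mem_increasingTuples, strictMono_cons_iff, Fin.forall_fin_succ, Fin.cons_zero,
    Fin.cons_succ, mem_Icc, Nat.succ_le_iff]
  constructor
  · rintro ⟨⟨hx, hj⟩, hlt, hmono⟩
    exact ⟨hx, fun i => ⟨hlt i, (hj i).2⟩, hmono⟩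
  · rintro ⟨hx, hj, hmono⟩
    exact ⟨⟨hx, fun i => ⟨hx.1.trans (hj i).1.le, (hj i).2⟩⟩, fun i => (hj i).1, hmono⟩

theorem sum_increasingTuples_succ {M : Type*} [AddCommMonoid M] (r a m : ℕ)
    (F : (Fin (r + 1) → ℕ) → M) :
    ∑ j ∈ increasingTuples (r + 1) a m, F j =
      ∑ x ∈ Icc a m, ∑ j ∈ increasingTuples r (x + 1) m, F (Fin.cons x j) := by
  rw [sum_sigma']
  refine sum_bij' (fun j _ => ⟨j 0, Fin.tail j⟩) (fun y _ => Fin.cons y.1 y.2)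
    (fun j hj => ?_) (fun y hy => cons_mem_increasingTuples.mpr (mem_sigma.mp hy))
    (fun j _ => Fin.cons_self_tail j) (fun _ _ => rfl)
    fun j _ => congrArg F (Fin.cons_self_tail j).symm
  rw [← Fin.cons_self_tail j] at hj
  exact mem_sigma.mpr (cons_mem_increasingTuples.mp hj)

theorem prod_Icc_eq_one_add_sum {R : Type*} [CommRing R] (f : ℕ → R) (a m : ℕ) :
    ∏ j ∈ Icc a m, f j = 1 + ∑ x ∈ Icc a m, (f x - 1) * ∏ j ∈ Icc (x + 1) m, f j := by
  rcases Nat.lt_or_ge m a with h | h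
  · simp [h]
  induction h using Nat.decreasingInduction with
  | self => simp
  | of_succ a ha ih =>
    simp only [← mul_prod_Ioc_eq_prod_Icc ha.le, ← add_sum_Ioc_eq_sum_Icc ha.le,
      ← Icc_add_one_left_eq_Ioc] at ih ⊢
    linear_combination ih

theorem coeff_mul_of_constantCoeff_eq_zero {R : Type*} [CommRing R] {f : R⟦X⟧}
    (hf : constantCoeff f = 0) (g : R⟦X⟧) (k : ℕ) :
    coeff k (f * g) = ∑ x ∈ Icc 1 k, coeff x f * coeff (k - x) g := by
  rw [coeff_mul, Nat.sum_antidiagonal_eq_sum_range_succ_mk, sum_range_succ',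
    coeff_zero_eq_constantCoeff_apply, hf, zero_mul, add_zero, range_eq_Ico,
    sum_Ico_add' (fun x => coeff x f * coeff (k - x) g), zero_add]
  rfl

section TupleSum

variable {R : Type*} [CommRing R] (f : ℕ → R⟦X⟧)

/-- The contribution `∑_{a ≤ j₁ < ⋯ < j_r ≤ m} ∏ i, coeff m_i (f j_i)` of the list
`m_1, …, m_r` of exponents to the expansion of the product of the `f j` with `a ≤ j ≤ m`. -/
noncomputable def tupleSum (m a : ℕ) (l : List ℕ) : R :=
  ∑ j ∈ increasingTuples l.length a m, ∏ i : Fin l.length, coeff (l.getD i 0) (f (j i))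

theorem tupleSum_nil (m a : ℕ) : tupleSum f m a [] = 1 := by
  simp [tupleSum, increasingTuples]

theorem tupleSum_cons (m a x : ℕ) (l : List ℕ) :
    tupleSum f m a (x :: l) = ∑ y ∈ Icc a m, coeff x (f y) * tupleSum f m (y + 1) l := by
  refine (sum_increasingTuples_succ l.length a m _).trans (sum_congr rfl fun y _ => ?_)
  rw [tupleSum, mul_sum]
  exact sum_congr rfl fun j _ => Fin.prod_univ_succ _

theorem sum_composition_tupleSum {f : ℕ → R⟦X⟧} (hf : ∀ j, constantCoeff (f j) = 1) (m k a : ℕ) :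
    ∑ c : Composition k, tupleSum f m a c.blocks = coeff k (∏ j ∈ Icc a m, f j) := by
  induction k using Nat.strong_induction_on generalizing a with
  | _ k ih =>
    rcases eq_or_ne k 0 with rfl | hk
    · have hnil (c : Composition 0) : c.blocks = [] := c.blocks_eq_nil.mpr rfl
      simp [hnil, tupleSum_nil, composition_card, map_prod, hf]
    · have hcoeff (x y : ℕ) (hx : x ∈ Icc 1 k) : coeff x (f y - 1) = coeff x (f y) := by
        rw [map_sub, coeff_one, if_neg (Nat.one_le_iff_ne_zero.mp (mem_Icc.mp hx).1), sub_zero]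
      have hzero (y : ℕ) : constantCoeff (f y - 1) = 0 := by rw [map_sub, hf, map_one, sub_self]
      rw [sum_composition_eq_sum_cons _ hk, prod_Icc_eq_one_add_sum, map_add, coeff_one,
        if_neg hk, zero_add, map_sum]
      simp only [coeff_mul_of_constantCoeff_eq_zero (hzero _), tupleSum_cons]
      rw [sum_comm]
      refine sum_congr rfl fun x hx => ?_
      rw [sum_comm]
      refine sum_congr rfl fun y _ => ?_
      rw [← mul_sum, ih (k - x) (by have := mem_Icc.mp hx; omega), hcoeff x y hx]

end TupleSum

end Compositions

section Omega

theorem coeff_succ_oddWeight (k f : ℕ) :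
    coeff (k + 1) (oddWeight f) = ((f + k).choose (2 * k + 1) : ℤ) := by
  rw [oddWeight, coeff_succ_X_mul, coeff_mk]

variable {n : ℕ} (p : n.Partition)

/-- The summand of `ω_k(π)` that belongs to the composition of `k` with the given blocks. -/
def omegaTerm (blocks : List ℕ) : ℕ :=
  (freq p 1 + blocks.getD 0 0 - 1).choose (2 * blocks.getD 0 0 - 1) *
    ∑ j ∈ indexTuples blocks.length (numDistinct p),
      ∏ i : Fin (blocks.length - 1),
        (freq p (j i) + blocks.getD (i + 1) 0).choose (2 * blocks.getD (i + 1) 0)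

theorem omega_eq_sum_omegaTerm (k : ℕ) :
    omega k p = ∑ c : Composition k, omegaTerm p c.blocks := rfl

theorem omegaTerm_cons {x : ℕ} (hx : x ≠ 0) (l : List ℕ) :
    (omegaTerm p (x :: l) : ℤ) = coeff x (oddWeight (freq p 1)) *
      tupleSum (fun j => evenWeight (freq p j)) (numDistinct p) 2 l := by
  obtain ⟨x, rfl⟩ := Nat.exists_eq_succ_of_ne_zero hx
  rw [coeff_succ_oddWeight, omegaTerm, Nat.cast_mul, Nat.cast_sum]
  refine congrArg₂ (· * ·) rfl (sum_congr rfl fun j _ => ?_)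
  rw [Nat.cast_prod]
  exact prod_congr rfl fun i _ => by simp only [evenWeight, coeff_mk, List.getD_cons_succ]

theorem omega_eq_coeff {k : ℕ} (hk : k ≠ 0) :
    (omega k p : ℤ) = coeff k (oddWeight (freq p 1) *
      ∏ j ∈ Icc 2 (numDistinct p), evenWeight (freq p j)) := by
  have heven (j : ℕ) : constantCoeff (evenWeight (freq p j)) = 1 := by
    rw [← coeff_zero_eq_constantCoeff_apply, evenWeight, coeff_mk, Nat.choose_zero_right,
      Nat.cast_one]
  have hodd : constantCoeff (oddWeight (freq p 1)) = 0 := by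
    rw [oddWeight, map_mul, constantCoeff_X, zero_mul]
  rw [omega_eq_sum_omegaTerm, sum_composition_eq_sum_cons _ hk,
    coeff_mul_of_constantCoeff_eq_zero hodd, Nat.cast_sum]
  refine sum_congr rfl fun x hx => ?_
  have hx : x ≠ 0 := Nat.one_le_iff_ne_zero.mp (mem_Icc.mp hx).1
  simp only [Nat.cast_sum, omegaTerm_cons p hx]
  rw [← mul_sum, sum_composition_tupleSum heven]

theorem prod_Icc_two_getD {M : Type*} [CommMonoid M] (g : ℕ → M) (a : ℕ) (l : List ℕ) :
    ∏ j ∈ Icc 2 (l.length + 1), g ((a :: l).getD (j - 1) 0) = (l.map g).prod := by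
  have hIcc : Icc 2 (l.length + 1) = Ico 2 (2 + l.length) := by
    ext
    simp only [mem_Icc, mem_Ico]
    omega
  rw [hIcc, prod_Ico_eq_prod_range, Nat.add_sub_cancel_left, prod_range,
    ← Fin.prod_univ_fun_getElem]
  refine prod_congr rfl fun i _ => ?_
  rw [show 2 + (i : ℕ) - 1 = i + 1 by omega, List.getD_cons_succ,
    List.getD_eq_getElem _ _ i.isLt]

theorem sort_eq_min'_cons {s : Finset ℕ} (hs : s.Nonempty) :
    s.sort (· ≤ ·) = s.min' hs :: (s.erase (s.min' hs)).sort (· ≤ ·) := by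
  conv_lhs => rw [← insert_erase (s.min'_mem hs)]
  exact sort_insert _ (fun i hi => s.min'_le i (mem_of_mem_erase hi)) (notMem_erase _ _)

theorem prod_Icc_two_sort_getD {M : Type*} [CommMonoid M] (g : ℕ → M) {s : Finset ℕ}
    (hs : s.Nonempty) :
    ∏ j ∈ Icc 2 #s, g ((s.sort (· ≤ ·)).getD (j - 1) 0) = ∏ i ∈ s.erase (s.min' hs), g i := by
  rw [sort_eq_min'_cons hs, ← card_erase_add_one (s.min'_mem hs),
    ← length_sort (s := s.erase (s.min' hs)) (· ≤ ·), prod_Icc_two_getD,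
    ← List.prod_toFinset _ (sort_nodup _ _), sort_toFinset]

theorem oddWeight_freq_one_mul_prod {N : ℕ} (hN : n ≤ N) (hp : p.parts.toFinset.Nonempty) :
    oddWeight (freq p 1) * ∏ j ∈ Icc 2 (numDistinct p), evenWeight (freq p j) =
      oddWeight (p.parts.count (p.parts.toFinset.min' hp)) *
        ∏ i ∈ Ioc (p.parts.toFinset.min' hp) N, evenWeight (p.parts.count i) := by
  have hfirst : distinctPart p 1 = p.parts.toFinset.min' hp := by
    rw [distinctPart, sort_eq_min'_cons hp]
    rfl
  have hrest := prod_Icc_two_sort_getD (fun i => evenWeight (p.parts.count i)) hp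
  rw [freq, hfirst]
  refine congrArg₂ (· * ·) rfl (hrest.trans (prod_subset (fun i hi => ?_) fun i hi hi' => ?_))
  · have hmem := Multiset.mem_toFinset.mp (mem_of_mem_erase hi)
    exact mem_Ioc.mpr ⟨min'_lt_of_mem_erase_min' _ hp hi,
      (Nat.Partition.le_of_mem_parts hmem).trans hN⟩
  · have hne := (mem_Ioc.mp hi).1.ne'
    have hmem : i ∉ p.parts := fun h => hi' (mem_erase.mpr ⟨hne, Multiset.mem_toFinset.mpr h⟩)
    rw [Multiset.count_eq_zero.mpr hmem, evenWeight_zero]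

/-- The weight of a part `i` in a partition whose smallest part is `a`. -/
noncomputable def smallestPartWeight (a i : ℕ) : ℕ → ℤ⟦X⟧ :=
  Function.update (fun _ => evenWeight) a oddWeight i

theorem prod_Icc_smallestPartWeight {M : Type*} [CommMonoid M] (F : ℕ → (ℕ → ℤ⟦X⟧) → M)
    {a N : ℕ} (h : a ≤ N) :
    ∏ i ∈ Icc a N, F i (smallestPartWeight a i) =
      F a oddWeight * ∏ i ∈ Ioc a N, F i evenWeight := by
  rw [← mul_prod_Ioc_eq_prod_Icc h, smallestPartWeight, Function.update_self]
  refine congrArg _ (prod_congr rfl fun i hi => ?_)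
  rw [smallestPartWeight, Function.update_of_ne (mem_Ioc.mp hi).1.ne']

theorem sum_prod_smallestPartWeight {N : ℕ} (hn : n ≠ 0) (hN : n ≤ N) :
    ∑ a ∈ Icc 1 N with ∀ i ∈ p.parts, i ∈ Icc a N,
        ∏ i ∈ Icc a N, smallestPartWeight a i (p.parts.count i) =
      oddWeight (freq p 1) * ∏ j ∈ Icc 2 (numDistinct p), evenWeight (freq p j) := by
  have hp : p.parts.toFinset.Nonempty := Multiset.toFinset_nonempty.mpr (parts_ne_zero p hn)
  have hmem := Multiset.mem_toFinset.mp (p.parts.toFinset.min'_mem hp)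
  have hmin (i : ℕ) (hi : i ∈ p.parts) : p.parts.toFinset.min' hp ≤ i :=
    min'_le _ _ (Multiset.mem_toFinset.mpr hi)
  have hle (i : ℕ) (hi : i ∈ p.parts) : i ≤ N := (Nat.Partition.le_of_mem_parts hi).trans hN
  rw [oddWeight_freq_one_mul_prod p hN hp,
    ← prod_Icc_smallestPartWeight (fun i w => w (p.parts.count i)) (hle _ hmem)]
  refine sum_eq_single_of_mem _ (mem_filter.mpr ⟨mem_Icc.mpr ⟨p.parts_pos hmem, hle _ hmem⟩,
    fun i hi => mem_Icc.mpr ⟨hmin i hi, hle i hi⟩⟩) fun a ha hne => ?_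
  obtain ⟨haN, hall⟩ := mem_filter.mp ha
  have hcount : p.parts.count a = 0 := Multiset.count_eq_zero.mpr fun h =>
    hne ((mem_Icc.mp (hall _ hmem)).1.antisymm (hmin a h))
  rw [prod_Icc_smallestPartWeight (fun i w => w (p.parts.count i)) (mem_Icc.mp haN).2, hcount,
    oddWeight_zero, zero_mul]

theorem spt_eq_coeff {k n N : ℕ} (hk : k ≠ 0) (hn : n ≠ 0) (hN : n ≤ N) :
    (spt k n : ℤ) = coeff k (coeff n (sptSeries N)) := by
  have hsum (a : ℕ) (ha : a ∈ Icc 1 N) :=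
    sum_prod_count_eq_coeff (smallestPartWeight a) (s := Icc a N)
      (fun h => Nat.not_succ_le_zero 0 ((mem_Icc.mp ha).1.trans (mem_Icc.mp h).1)) n
  have hseries : sptSeries N =
      ∑ a ∈ Icc 1 N, ∏ i ∈ Icc a N, partSeries i (smallestPartWeight a i) :=
    sum_congr rfl fun a ha => (prod_Icc_smallestPartWeight _ (mem_Icc.mp ha).2).symm
  rw [spt, Nat.cast_sum, hseries, map_sum, ← sum_congr rfl hsum,
    sum_comm' (t' := univ) (s' := fun p : n.Partition =>
      {a ∈ Icc 1 N | ∀ i ∈ p.parts, i ∈ Icc a N}) (by simp), map_sum]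
  refine sum_congr rfl fun p _ => ?_
  rw [omega_eq_coeff p hk, sum_prod_smallestPartWeight p hn hN]

end Omega

section Moments

theorem sum_Icc_neg_eq {M : Type*} [AddCommGroup M] (f : ℤ → M) (n : ℕ) :
    ∑ m ∈ Icc (-(n : ℤ)) n, f m = f 0 + (∑ m ∈ Icc 1 n, f m + ∑ m ∈ Icc 1 n, f (-m)) := by
  induction n with
  | zero => simp
  | succ n ih =>
    have hIcc : Icc (-((n + 1 : ℕ) : ℤ)) (n + 1 : ℕ) =
        insert ((n + 1 : ℕ) : ℤ) (insert (-((n + 1 : ℕ) : ℤ)) (Icc (-(n : ℤ)) n)) := by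
      ext i; simp only [mem_insert, mem_Icc]; omega
    have hneg : -((n + 1 : ℕ) : ℤ) ∉ Icc (-(n : ℤ)) n := by rw [mem_Icc]; omega
    have hpos : ((n + 1 : ℕ) : ℤ) ∉ insert (-((n + 1 : ℕ) : ℤ)) (Icc (-(n : ℤ)) n) := by
      rw [mem_insert, mem_Icc]; omega
    rw [hIcc, sum_insert hpos, sum_insert hneg, ih, sum_Icc_succ_top n.succ_pos,
      sum_Icc_succ_top n.succ_pos]
    abel

theorem choose_add_two_mul_eq_sum {k : ℕ} (hk : k ≠ 0) (m : ℕ) :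
    ((m + k).choose (2 * k) : ℤ) = ∑ r ∈ Icc 1 m, coeff k (oddWeight r) := by
  obtain ⟨k, rfl⟩ := Nat.exists_eq_succ_of_ne_zero hk
  induction m with
  | zero => simp [Nat.choose_eq_zero_of_lt (show k + 1 < 2 * (k + 1) by omega)]
  | succ m ih =>
    rw [sum_Icc_succ_top m.succ_pos, ← ih, coeff_succ_oddWeight, ← Nat.cast_add, Nat.cast_inj,
      Nat.succ_eq_add_one, show m + 1 + (k + 1) = m + (k + 1) + 1 by ring,
      show m + 1 + k = m + (k + 1) by ring, show 2 * (k + 1) = 2 * k + 1 + 1 by ring,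
      Nat.choose_succ_succ', add_comm]

theorem choose_natCast_add {k : ℕ} (hk : k ≠ 0) {m : ℕ} (hm : m ≠ 0) :
    Ring.choose ((m : ℤ) + (((2 * k : ℕ) : ℤ) - 1) / 2) (2 * k) =
      ∑ r ∈ Icc 1 (m - 1), coeff k (oddWeight r) := by
  rw [show (m : ℤ) + (((2 * k : ℕ) : ℤ) - 1) / 2 = ((m - 1 + k : ℕ) : ℤ) by omega,
    Ring.choose_natCast, choose_add_two_mul_eq_sum hk]

theorem choose_neg_natCast_add {k : ℕ} (hk : k ≠ 0) (m : ℕ) :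
    Ring.choose (-(m : ℤ) + (((2 * k : ℕ) : ℤ) - 1) / 2) (2 * k) =
      ∑ r ∈ Icc 1 m, coeff k (oddWeight r) := by
  rw [show -(m : ℤ) + (((2 * k : ℕ) : ℤ) - 1) / 2 = -((m : ℤ) - k + 1) by omega,
    Ring.choose_neg, show ((2 * k : ℕ) : ℤ) = 2 * (k : ℤ) by push_cast; ring,
    Int.negOnePow_two_mul, one_smul,
    show (m : ℤ) - k + 1 + 2 * (k : ℤ) - 1 = ((m + k : ℕ) : ℤ) by push_cast; ring,
    Ring.choose_natCast, choose_add_two_mul_eq_sum hk]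

theorem sum_choose_mul_eq {k : ℕ} (hk : k ≠ 0) (n : ℕ) (g : ℤ → ℤ) :
    ∑ m ∈ Icc (-(n : ℤ)) n, Ring.choose (m + (((2 * k : ℕ) : ℤ) - 1) / 2) (2 * k) * g m =
      ∑ r ∈ Icc 1 n, coeff k (oddWeight r) *
        (∑ m ∈ Icc (r + 1) n, g m + ∑ m ∈ Icc r n, g (-m)) := by
  have hzero := choose_neg_natCast_add hk 0
  rw [Nat.cast_zero, neg_zero, Icc_eq_empty_of_lt one_pos, sum_empty] at hzero
  rw [sum_Icc_neg_eq, hzero, zero_mul, zero_add]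
  simp only [mul_add, sum_add_distrib, mul_sum]
  refine congrArg₂ (· + ·) ?_ ?_
  · rw [sum_comm' (t' := Icc 1 n) (s' := fun m => Icc 1 (m - 1))
      fun r m => by simp only [mem_Icc]; omega]
    refine sum_congr rfl fun m hm => ?_
    rw [choose_natCast_add hk (Nat.one_le_iff_ne_zero.mp (mem_Icc.mp hm).1), sum_mul]
  · rw [sum_comm' (t' := Icc 1 n) (s' := fun m => Icc 1 m)
      fun r m => by simp only [mem_Icc]; omega]
    exact sum_congr rfl fun m _ => by rw [choose_neg_natCast_add hk, sum_mul]

theorem sum_card_filter_eq_natCast {α : Type*} [Fintype α] {s : α → ℤ} {n : ℕ}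
    (hs : ∀ a, s a ≤ n) (r : ℕ) : ∑ m ∈ Icc r n, #{a | s a = m} = #{a | r ≤ s a} := by
  rw [card_eq_sum_card_fiberwise (f := fun a => (s a).toNat) (t := Icc r n)]
  · refine sum_congr rfl fun m hm => ?_
    have hrm := (mem_Icc.mp hm).1
    rw [filter_filter]
    exact congrArg card (filter_congr fun a _ => by omega)
  · intro a ha
    have hra := (mem_filter.mp ha).2
    have han := hs a
    simp only [coe_Icc, Set.mem_Icc]
    omega

theorem sum_rankCount (r n : ℕ) :
    ∑ m ∈ Icc r n, rankCount m n = coeff n (rankGeSeries r) := by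
  have hle (p : n.Partition) : rank p ≤ n := (abs_le.mp (abs_rank_le p)).2
  rw [rankGeSeries, coeff_mk, rankGe, ← sum_card_filter_eq_natCast hle, Nat.cast_sum]
  rfl

theorem sum_rankCount_neg (r n : ℕ) :
    ∑ m ∈ Icc r n, rankCount (-m) n = coeff n (rankLeSeries r) := by
  have hle (p : n.Partition) : -rank p ≤ n := neg_le.mp (abs_le.mp (abs_rank_le p)).1
  have hsum := sum_card_filter_eq_natCast hle r
  simp only [neg_eq_iff_eq_neg, le_neg (a := (r : ℤ))] at hsum
  rw [rankLeSeries, coeff_mk, rankLe, ← hsum, Nat.cast_sum]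
  rfl

end Moments

section Appell

/-- The coefficient `(-1) ^ j q ^ (c j (j + 1) / 2 + e (j + 1))` of an Appell sum, with `j` starting
from `0`: for `c = 1`, `e = 0` it belongs to the crank, for `c = 3`, `e = 1` to the rank. -/
noncomputable def appellCoeff (R : Type*) [CommRing R] (c e j : ℕ) : R⟦X⟧ :=
  (-1) ^ j * X ^ (c * (j + 1).choose 2 + e * (j + 1))

theorem baileyAlpha_eq (R : Type*) [CommRing R] (j : ℕ) :
    baileyAlpha R j = (appellCoeff R 1 0 j - appellCoeff R 3 1 j) * (1 + X ^ (j + 1)) := by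
  simp only [baileyAlpha, appellCoeff, one_mul, zero_mul, add_zero, mul_sub]

theorem eq_sum_of_recurrence {R : Type*} [CommRing R] {P : R⟦X⟧} {G : ℕ → R⟦X⟧} {c e : ℕ}
    (hG : ∀ r, r ≠ 0 → G r = X ^ (r + e) * (P - G (r + c))) {r : ℕ} (hr : r ≠ 0) (J : ℕ) :
    G r = P * ∑ j ∈ range J, appellCoeff R c e j * X ^ ((j + 1) * r) +
      (-1) ^ J * X ^ (J * r + e * J + c * J.choose 2) * G (r + c * J) := by
  induction J with
  | zero => simp
  | succ J ih =>
    have hchoose : (J + 1).choose 2 = J.choose 2 + J := by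
      rw [Nat.choose_succ_succ' J 1, Nat.choose_one_right, add_comm]
    rw [sum_range_succ, ih, appellCoeff, hchoose]
    nth_rewrite 1 [hG (r + c * J) (by omega)]
    rw [show r + c * J + c = r + c * (J + 1) by ring]
    ring

theorem coeff_eq_of_recurrence {R : Type*} [CommRing R] {P : R⟦X⟧} {G : ℕ → R⟦X⟧} {c e : ℕ}
    (hG : ∀ r, r ≠ 0 → G r = X ^ (r + e) * (P - G (r + c))) {r : ℕ} (hr : r ≠ 0) (n : ℕ) :
    coeff n (G r) =
      coeff n (P * ∑ j ∈ range (n + 1), appellCoeff R c e j * X ^ ((j + 1) * r)) := by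
  refine coeff_eq_of_X_pow_dvd_sub (m := n + 1) ?_ n.lt_succ_self
  rw [eq_sum_of_recurrence hG hr (n + 1), add_sub_cancel_left]
  refine Dvd.dvd.mul_right (Dvd.dvd.mul_left (pow_dvd_pow _ ?_) _) _
  exact (Nat.le_mul_of_pos_right _ (Nat.pos_of_ne_zero hr)).trans (by omega)

theorem X_pow_dvd_partSeries_sub {R : Type*} [CommRing R] {i : ℕ} (hi : i ≠ 0) {a : ℕ → R}
    (ha : a 0 = 0) (n : ℕ) :
    X ^ (n + 1) ∣ partSeries i a - ∑ r ∈ Icc 1 n, C (a r) * X ^ (i * r) := by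
  rw [X_pow_dvd_iff]
  intro m hm
  simp only [map_sub, map_sum, coeff_partSeries, coeff_C_mul, coeff_X_pow, sub_eq_zero]
  split_ifs with h
  · obtain ⟨c, rfl⟩ := h
    have hcn : c ≤ n := by
      have := Nat.le_mul_of_pos_left c (Nat.pos_of_ne_zero hi)
      omega
    simp only [Nat.mul_div_cancel_left _ (Nat.pos_of_ne_zero hi), Nat.mul_right_inj hi, mul_ite,
      mul_one, mul_zero, sum_ite_eq, mem_Icc]
    split_ifs with hc
    · rfl
    · rw [show c = 0 by omega, ha]
  · refine (sum_eq_zero fun r _ => ?_).symm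
    rw [if_neg fun hmr => h ⟨r, hmr⟩, mul_zero]

theorem sum_choose_mul_eq_coeff {k : ℕ} (hk : k ≠ 0) {n c e : ℕ} {P : ℤ⟦X⟧} {g : ℤ → ℤ}
    (hpos : ∀ r : ℕ, r ≠ 0 → ∑ m ∈ Icc r n, g m =
      coeff n (P * ∑ j ∈ range (n + 1), appellCoeff ℤ c e j * X ^ ((j + 1) * r)))
    (hneg : ∀ r : ℕ, r ≠ 0 → ∑ m ∈ Icc r n, g (-m) =
      coeff n (P * ∑ j ∈ range (n + 1), appellCoeff ℤ c e j * X ^ ((j + 1) * r))) :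
    ∑ m ∈ Icc (-(n : ℤ)) n, Ring.choose (m + (((2 * k : ℕ) : ℤ) - 1) / 2) (2 * k) * g m =
      coeff n (P * ∑ j ∈ range (n + 1), appellCoeff ℤ c e j * (1 + X ^ (j + 1)) *
        partSeries (j + 1) fun r => coeff k (oddWeight r)) := by
  have htail (r : ℕ) (hr : r ∈ Icc 1 n) : coeff k (oddWeight r) *
        (∑ m ∈ Icc (r + 1) n, g m + ∑ m ∈ Icc r n, g (-m)) =
      coeff n (P * ∑ j ∈ range (n + 1), appellCoeff ℤ c e j * (1 + X ^ (j + 1)) *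
        (C (coeff k (oddWeight r)) * X ^ ((j + 1) * r))) := by
    rw [hpos (r + 1) r.succ_ne_zero, hneg r (Nat.one_le_iff_ne_zero.mp (mem_Icc.mp hr).1),
      ← map_add, ← mul_add, ← sum_add_distrib, ← coeff_C_mul, mul_left_comm, mul_sum]
    congr 2
    exact sum_congr rfl fun j _ => by ring
  rw [sum_choose_mul_eq hk, sum_congr rfl htail, ← map_sum, ← mul_sum, sum_comm]
  symm
  refine coeff_eq_of_X_pow_dvd_sub (m := n + 1) ?_ n.lt_succ_self
  rw [← mul_sub, ← sum_sub_distrib]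
  refine Dvd.dvd.mul_left (dvd_sum fun j _ => ?_) _
  rw [← mul_sum, ← mul_sub]
  exact (X_pow_dvd_partSeries_sub j.succ_ne_zero (by simp) n).mul_left _

theorem mu_eq_coeff {k : ℕ} (hk : k ≠ 0) (n : ℕ) :
    mu (2 * k) n = coeff n (partitionSeries ℤ * ∑ j ∈ range (n + 1),
      appellCoeff ℤ 1 0 j * (1 + X ^ (j + 1)) *
        partSeries (j + 1) fun r => coeff k (oddWeight r)) := by
  have hcrank {r : ℕ} (hr : r ≠ 0) :=
    coeff_eq_of_recurrence (G := crankGeSeries) (c := 1) (e := 0)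
      (fun r _ => crankGeSeries_eq r) hr n
  exact sum_choose_mul_eq_coeff hk (g := fun m => crankCount m n)
    (fun r hr => (sum_crankCount hr n).trans (hcrank hr))
    fun r hr => (sum_crankCount_neg hr n).trans (hcrank hr)

theorem eta_eq_coeff {k : ℕ} (hk : k ≠ 0) (n : ℕ) :
    eta (2 * k) n = coeff n (partitionSeries ℤ * ∑ j ∈ range (n + 1),
      appellCoeff ℤ 3 1 j * (1 + X ^ (j + 1)) *
        partSeries (j + 1) fun r => coeff k (oddWeight r)) :=
  sum_choose_mul_eq_coeff hk (g := fun m => rankCount m n)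
    (fun r hr => (sum_rankCount r n).trans
      (coeff_eq_of_recurrence (fun _ => rankGeSeries_eq) hr n))
    fun r hr => (sum_rankCount_neg r n).trans
      (coeff_eq_of_recurrence (fun _ => rankLeSeries_eq) hr n)

theorem coeff_coeff_map_C_mul {R : Type*} [CommRing R] (F : R⟦X⟧) (f : R⟦X⟧⟦X⟧) (k n : ℕ) :
    coeff k (coeff n (PowerSeries.map C F * f)) =
      coeff n (F * PowerSeries.mk fun m => coeff k (coeff m f)) := by
  rw [coeff_mul, coeff_mul, map_sum]
  exact sum_congr rfl fun x _ => by rw [coeff_map, coeff_C_mul, coeff_mk]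

theorem map_partitionSeries {R S : Type*} [CommRing R] [CommRing S] (f : R →+* S) :
    PowerSeries.map f (partitionSeries R) = partitionSeries S := by
  ext n
  simp [partitionSeries]

theorem map_baileyAlpha {R S : Type*} [CommRing R] [CommRing S] (f : R →+* S) (r : ℕ) :
    PowerSeries.map f (baileyAlpha R r) = baileyAlpha S r := by
  simp [baileyAlpha]

theorem mk_coeff_coeff_partSeries {R : Type*} [CommRing R] (k i : ℕ) (a : ℕ → R⟦X⟧) :
    (PowerSeries.mk fun m => coeff k (coeff m (partSeries i a))) =
      partSeries i fun c => coeff k (a c) := by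
  ext m
  simp only [coeff_mk, coeff_partSeries, apply_ite (coeff k), map_zero]

theorem coeff_coeff_partitionSeries_mul_sum (k n N : ℕ) :
    coeff k (coeff n (partitionSeries ℤ⟦X⟧ *
        ∑ r ∈ range N, baileyAlpha ℤ⟦X⟧ r * partSeries (r + 1) oddWeight)) =
      coeff n (partitionSeries ℤ * ∑ r ∈ range N, baileyAlpha ℤ r *
        partSeries (r + 1) fun f => coeff k (oddWeight f)) := by
  simp only [mul_sum, map_sum]
  refine sum_congr rfl fun r _ => ?_
  rw [← map_partitionSeries C, ← map_baileyAlpha C, ← mul_assoc, ← map_mul,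
    coeff_coeff_map_C_mul, mk_coeff_coeff_partSeries, mul_assoc]

end Appell

end SptMoments

theorem mainTheorem3 (k n : ℕ) (hk : 1 ≤ k) (hn : 1 ≤ n) :
    (SptMoments.spt k n : ℤ) = SptMoments.mu (2 * k) n - SptMoments.eta (2 * k) n := by
  rw [Nat.one_le_iff_ne_zero] at hk hn
  rw [SptMoments.spt_eq_coeff hk hn n.le_succ, SptMoments.coeff_sptSeries n.le_succ,
    SptMoments.coeff_coeff_partitionSeries_mul_sum, SptMoments.mu_eq_coeff hk,
    SptMoments.eta_eq_coeff hk, ← map_sub, ← mul_sub, ← Finset.sum_sub_distrib]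
  simp only [SptMoments.baileyAlpha_eq, sub_mul]
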